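/- Let $M$ be a finite-dimensional smooth ($C^\infty$) manifold without boundary, Hausdorff, connected and paracompact. A \emph{metric} on $M$ means a smooth field $g$ of nondegenerate symmetric bilinear forms on the tangent spaces (positive definiteness is not required). For a smooth torsion-free Koszul connection $\nabla$ on $M$ and a metric $g$, let $\nabla^g$ be the Koszul connection defined by $$g(\nabla^g_XY,Z)=X\,g(Y,Z)-g(Y,\nabla_XZ)$$ for all vector fields $X,Y,Z$, and let $J_{\nabla\nabla^g}$ be the space of global smooth sections $\phi$ of $\mathrm{Hom}(TM,TM)$ that solve the gauge equation $\nabla^g\circ\phi=\phi\circ\nabla$, i.e. $\nabla^g_X(\phi(Y))=\phi(\nabla_XY)$ for all vector fields $X,Y$. For $\phi\in J_{\nabla\nabla^g}$ let $\Phi^*$ be the section of $\mathrm{Hom}(TM,TM)$ with $$g(\Phi^*(X),Y)=\tfrac12\left[g(\phi(X),Y)-g(X,\phi(Y))\right].$$ The form $g(\Phi^*\cdot,\cdot)$ is $\nabla$-parallel and $M$ is connected, so the rank of $\Phi^*(x):T_xM\to T_xM$ does not depend on $x\in M$; it is denoted by $\mathrm{rank}(\Phi^*)$. Put $$s^{*b}(\nabla,g)=\min_{\phi\in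 J_{\nabla\nabla^g}}\left[\dim M-\mathrm{rank}(\Phi^*)\right],\qquad s^{*b}(M)=\min_{(\nabla,g)}s^{*b}(\nabla,g),$$ where $(\nabla,g)$ runs over all pairs of a smooth torsion-free Koszul connection and a metric on $M$. Then the following assertions are equivalent: (1) $s^{*b}(M)=0$; (2) $M$ admits a symplectic structure, i.e. a smooth closed nondegenerate differential $2$-form. -/

import Mathlib

open Bundle FiberBundle
open scoped Manifold ContDiff

noncomputable section

/-! ## Metrics, symplectic forms and gauge transformations

`M` is a smooth manifold without boundary, modelled on a finite-dimensional real vector space `E`.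
All tensor fields are smooth sections of the corresponding bundles. -/

/-- A Riemannian metric in the general (possibly indefinite) sense: a smooth field of
nondegenerate symmetric bilinear forms on the tangent spaces. -/
structure PseudoRiemannianMetric (E : Type*) [NormedAddCommGroup E] [NormedSpace ℝ E]
    (M : Type*) [TopologicalSpace M] [ChartedSpace E M] [IsManifold 𝓘(ℝ, E) ∞ M] where
  /-- The bilinear form on each tangent space. -/
  val (x : M) : TangentSpace 𝓘(ℝ, E) x →L[ℝ] TangentSpace 𝓘(ℝ, E) x →L[ℝ] ℝ
  symm (x : M) (u v : TangentSpace 𝓘(ℝ, E) x) : val x u v = val x v u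
  nondegenerate (x : M) (u : TangentSpace 𝓘(ℝ, E) x) (hu : ∀ v, val x u v = 0) : u = 0
  contMDiff : ContMDiff 𝓘(ℝ, E) (𝓘(ℝ, E).prod 𝓘(ℝ, E →L[ℝ] E →L[ℝ] ℝ)) ∞
    (fun x ↦ TotalSpace.mk' (E →L[ℝ] E →L[ℝ] ℝ)
      (E := fun y : M ↦ TangentSpace 𝓘(ℝ, E) y →L[ℝ] TangentSpace 𝓘(ℝ, E) y →L[ℝ] ℝ) x (val x))

/-- A symplectic structure: a smooth nondegenerate closed differential 2-form `ω`. Closedness is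
`dω = 0`, with the exterior derivative evaluated on smooth vector fields by the invariant
formula. -/
structure SymplecticStructure (E : Type*) [NormedAddCommGroup E] [NormedSpace ℝ E]
    (M : Type*) [TopologicalSpace M] [ChartedSpace E M] [IsManifold 𝓘(ℝ, E) ∞ M] where
  /-- The bilinear form on each tangent space. -/
  val (x : M) : TangentSpace 𝓘(ℝ, E) x →L[ℝ] TangentSpace 𝓘(ℝ, E) x →L[ℝ] ℝ
  alt (x : M) (u : TangentSpace 𝓘(ℝ, E) x) : val x u u = 0
  nondegenerate (x : M) (u : TangentSpace 𝓘(ℝ, E) x) (hu : ∀ v, val x u v = 0) : u = 0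
  contMDiff : ContMDiff 𝓘(ℝ, E) (𝓘(ℝ, E).prod 𝓘(ℝ, E →L[ℝ] E →L[ℝ] ℝ)) ∞
    (fun x ↦ TotalSpace.mk' (E →L[ℝ] E →L[ℝ] ℝ)
      (E := fun y : M ↦ TangentSpace 𝓘(ℝ, E) y →L[ℝ] TangentSpace 𝓘(ℝ, E) y →L[ℝ] ℝ) x (val x))
  closed (X Y Z : Π x : M, TangentSpace 𝓘(ℝ, E) x)
    (hX : ContMDiff 𝓘(ℝ, E) (𝓘(ℝ, E).prod 𝓘(ℝ, E)) ∞ (T% X))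
    (hY : ContMDiff 𝓘(ℝ, E) (𝓘(ℝ, E).prod 𝓘(ℝ, E)) ∞ (T% Y))
    (hZ : ContMDiff 𝓘(ℝ, E) (𝓘(ℝ, E).prod 𝓘(ℝ, E)) ∞ (T% Z)) (x : M) :
    d% (fun y ↦ val y (Y y) (Z y)) x (X x) - d% (fun y ↦ val y (X y) (Z y)) x (Y x)
      + d% (fun y ↦ val y (X y) (Y y)) x (Z x)
      - val x (VectorField.mlieBracket 𝓘(ℝ, E) X Y x) (Z x)
      + val x (VectorField.mlieBracket 𝓘(ℝ, E) X Z x) (Y x)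
      - val x (VectorField.mlieBracket 𝓘(ℝ, E) Y Z x) (X x) = 0

/-- An infinitesimal gauge transformation: a smooth section of `Hom(TM, TM)`. -/
structure InfinitesimalGauge (E : Type*) [NormedAddCommGroup E] [NormedSpace ℝ E]
    (M : Type*) [TopologicalSpace M] [ChartedSpace E M] [IsManifold 𝓘(ℝ, E) ∞ M] where
  /-- The endomorphism of each tangent space. -/
  val (x : M) : TangentSpace 𝓘(ℝ, E) x →L[ℝ] TangentSpace 𝓘(ℝ, E) x
  contMDiff : ContMDiff 𝓘(ℝ, E) (𝓘(ℝ, E).prod 𝓘(ℝ, E →L[ℝ] E)) ∞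
    (fun x ↦ TotalSpace.mk' (E →L[ℝ] E)
      (E := fun y : M ↦ TangentSpace 𝓘(ℝ, E) y →L[ℝ] TangentSpace 𝓘(ℝ, E) y) x (val x))

/-- A smooth torsion-free Koszul connection on `M`. In `conn Y x u` the vector field `Y` is
differentiated at `x` in the direction `u`; on paper this is `∇_u Y`. -/
structure TorsionFreeConnection (E : Type*) [NormedAddCommGroup E] [NormedSpace ℝ E]
    [FiniteDimensional ℝ E]
    (M : Type*) [TopologicalSpace M] [ChartedSpace E M] [IsManifold 𝓘(ℝ, E) ∞ M] where
  /-- The covariant derivative on the tangent bundle. -/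
  conn : CovariantDerivative 𝓘(ℝ, E) E (TangentSpace 𝓘(ℝ, E) : M → Type _)
  smooth : CovariantDerivative.ContMDiffCovariantDerivative conn ∞
  torsion_eq_zero : conn.torsion = 0

/-! ## The dual connection of Amari -/

section

variable {E : Type*} [NormedAddCommGroup E] [NormedSpace ℝ E]
  {M : Type*} [TopologicalSpace M] [ChartedSpace E M] [IsManifold 𝓘(ℝ, E) ∞ M]

instance instT2SpaceTangent (x : M) : T2Space (TangentSpace 𝓘(ℝ, E) x) :=
  inferInstanceAs (T2Space E)

namespace PseudoRiemannianMetric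

variable (g : PseudoRiemannianMetric E M)

/-- The metric at `x` as an algebraic bilinear form. -/
def form (x : M) : LinearMap.BilinForm ℝ (TangentSpace 𝓘(ℝ, E) x) :=
  (ContinuousLinearMap.coeLM ℝ).comp (g.val x : _ →ₗ[ℝ] _)

theorem form_apply (x : M) (u v : TangentSpace 𝓘(ℝ, E) x) : g.form x u v = g.val x u v := rfl

theorem form_nondegenerate (x : M) : (g.form x).Nondegenerate :=
  ⟨fun u hu ↦ g.nondegenerate x u hu,
    fun u hu ↦ g.nondegenerate x u fun v ↦ (g.symm x u v).trans (hu v)⟩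

theorem mdifferentiableAt_apply {Y Z : Π x : M, TangentSpace 𝓘(ℝ, E) x} {x : M}
    (hY : MDiffAt (T% Y) x) (hZ : MDiffAt (T% Z) x) :
    MDiffAt (fun y ↦ g.val y (Y y) (Z y)) x := by
  have : MDifferentiableAt 𝓘(ℝ, E) (𝓘(ℝ, E).prod 𝓘(ℝ))
      (fun m ↦ TotalSpace.mk' ℝ (E := Bundle.Trivial M ℝ) m (g.val m (Y m) (Z m))) x := by
    apply MDifferentiableAt.clm_bundle_apply₂ (F₁ := E) (F₂ := E)
    · exact g.contMDiff.mdifferentiableAt (by simp)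
    · exact hY
    · exact hZ
  simp only [mdifferentiableAt_totalSpace] at this
  exact this.2

/-- For a connection `∇` and vector fields `Y`, `Z`, this is the linear form
`u ↦ u g(Y, Z) - g(Y, ∇_u Z)` on the tangent space at `x`. -/
def dualPairing (D : CovariantDerivative 𝓘(ℝ, E) E (TangentSpace 𝓘(ℝ, E) : M → Type _))
    (Y Z : Π x : M, TangentSpace 𝓘(ℝ, E) x) (x : M) : TangentSpace 𝓘(ℝ, E) x →L[ℝ] ℝ :=
  d% (fun y ↦ g.val y (Y y) (Z y)) x - (g.val x (Y x)).comp (D Z x)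

theorem dualPairing_tensorial
    (D : CovariantDerivative 𝓘(ℝ, E) E (TangentSpace 𝓘(ℝ, E) : M → Type _))
    {Y : Π x : M, TangentSpace 𝓘(ℝ, E) x} {x : M} (hY : MDiffAt (T% Y) x) :
    TensorialAt 𝓘(ℝ, E) E (fun Z ↦ g.dualPairing D Y Z x) x where
  smul {f Z} hf hZ := by
    have h := mvfderiv_fun_mul hf (g.mdifferentiableAt_apply hY hZ)
    ext u
    simp [dualPairing, D.isCovariantDerivativeOn.leibniz hZ hf, h]
    ring
  add {Z Z'} hZ hZ' := by
    have h := mvfderiv_fun_add (g.mdifferentiableAt_apply hY hZ) (g.mdifferentiableAt_apply hY hZ')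
    ext u
    simp [dualPairing, D.isCovariantDerivativeOn.add hZ hZ', h]
    abel

theorem ext_val {x : M} {u v : TangentSpace 𝓘(ℝ, E) x}
    (h : ∀ Z : Π x : M, TangentSpace 𝓘(ℝ, E) x, MDiffAt (T% Z) x →
      g.val x u (Z x) = g.val x v (Z x)) : u = v := by
  refine sub_eq_zero.1 (g.nondegenerate x _ fun z ↦ ?_)
  have := h (FiberBundle.extend E z) (mdifferentiableAt_extend ..)
  simp only [FiberBundle.extend_apply_self] at this
  simp [this]

/-- The form `ω(g, φ)(u, v) = (g(φ u, v) - g(u, φ v)) / 2` on the tangent space at `x`. -/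
def skewForm (φ : InfinitesimalGauge E M) (x : M) :
    LinearMap.BilinForm ℝ (TangentSpace 𝓘(ℝ, E) x) :=
  (1 / 2 : ℝ) • ((g.form x).compLeft (φ.val x) - (g.form x).compRight (φ.val x))

theorem skewForm_apply (φ : InfinitesimalGauge E M) (x : M) (u v : TangentSpace 𝓘(ℝ, E) x) :
    g.skewForm φ x u v = (1 / 2 : ℝ) * (g.val x (φ.val x u) v - g.val x u (φ.val x v)) := rfl

end PseudoRiemannianMetric

end

section

variable {E : Type*} [NormedAddCommGroup E] [NormedSpace ℝ E] [FiniteDimensional ℝ E]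
  {M : Type*} [TopologicalSpace M] [ChartedSpace E M] [IsManifold 𝓘(ℝ, E) ∞ M]

instance instFiniteDimensionalTangent (x : M) :
    FiniteDimensional ℝ (TangentSpace 𝓘(ℝ, E) x) :=
  inferInstanceAs (FiniteDimensional ℝ E)

namespace PseudoRiemannianMetric

variable (g : PseudoRiemannianMetric E M)

/-- The vector `g`-dual to a linear form on the tangent space at `x`. -/
def sharp (x : M) : Module.Dual ℝ (TangentSpace 𝓘(ℝ, E) x) ≃ₗ[ℝ] TangentSpace 𝓘(ℝ, E) x :=
  ((g.form x).toDual (g.form_nondegenerate x)).symm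

theorem val_sharp (x : M) (α : Module.Dual ℝ (TangentSpace 𝓘(ℝ, E) x))
    (v : TangentSpace 𝓘(ℝ, E) x) : g.val x (g.sharp x α) v = α v :=
  LinearMap.BilinForm.apply_toDual_symm_apply (B := g.form x) (hB := g.form_nondegenerate x) α v

open Classical in
/-- The bilinear form `(z, u) ↦ u g(Y, Z) - g(Y, ∇_u Z)` on the tangent space at `x`, where `Z` is
any vector field with value `z` at `x` (and `Y` is differentiable at `x`). -/
def dualForm (D : CovariantDerivative 𝓘(ℝ, E) E (TangentSpace 𝓘(ℝ, E) : M → Type _))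
    (Y : Π x : M, TangentSpace 𝓘(ℝ, E) x) (x : M) :
    TangentSpace 𝓘(ℝ, E) x →L[ℝ] TangentSpace 𝓘(ℝ, E) x →L[ℝ] ℝ :=
  if hY : MDiffAt (T% Y) x then
    TensorialAt.mkHom (fun Z ↦ g.dualPairing D Y Z x) x (g.dualPairing_tensorial D hY)
  else 0

theorem dualForm_apply (D : CovariantDerivative 𝓘(ℝ, E) E (TangentSpace 𝓘(ℝ, E) : M → Type _))
    {Y Z : Π x : M, TangentSpace 𝓘(ℝ, E) x} {x : M}
    (hY : MDiffAt (T% Y) x) (hZ : MDiffAt (T% Z) x) :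
    g.dualForm D Y x (Z x) = g.dualPairing D Y Z x := by
  rw [dualForm, dif_pos hY, TensorialAt.mkHom_apply _ hZ]

/-- The underlying operator of the connection `∇^g`: the vector `∇^g_u Y` is the one whose
`g`-product with every `z` is `u g(Y, Z) - g(Y, ∇_u Z)`. -/
def dualFun (D : CovariantDerivative 𝓘(ℝ, E) E (TangentSpace 𝓘(ℝ, E) : M → Type _))
    (Y : Π x : M, TangentSpace 𝓘(ℝ, E) x) (x : M) :
    TangentSpace 𝓘(ℝ, E) x →L[ℝ] TangentSpace 𝓘(ℝ, E) x :=
  LinearMap.toContinuousLinearMap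
    ((g.sharp x).toLinearMap.comp
      ((ContinuousLinearMap.coeLM ℝ).comp (g.dualForm D Y x : _ →ₗ[ℝ] _)).flip)

theorem val_dualFun (D : CovariantDerivative 𝓘(ℝ, E) E (TangentSpace 𝓘(ℝ, E) : M → Type _))
    {Y Z : Π x : M, TangentSpace 𝓘(ℝ, E) x} {x : M}
    (hY : MDiffAt (T% Y) x) (hZ : MDiffAt (T% Z) x) (u : TangentSpace 𝓘(ℝ, E) x) :
    g.val x (g.dualFun D Y x u) (Z x) =
      d% (fun y ↦ g.val y (Y y) (Z y)) x u - g.val x (Y x) (D Z x u) := by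
  have h : g.val x (g.dualFun D Y x u) (Z x) = g.dualForm D Y x (Z x) u := g.val_sharp x _ _
  rw [h, g.dualForm_apply D hY hZ]
  rfl

/-- The connection `∇^g` dual to `∇` with respect to `g`, characterised by
`g(∇^g_X Y, Z) = X g(Y, Z) - g(Y, ∇_X Z)`, see `val_dualFun`. -/
def dualConnection (D : CovariantDerivative 𝓘(ℝ, E) E (TangentSpace 𝓘(ℝ, E) : M → Type _)) :
    CovariantDerivative 𝓘(ℝ, E) E (TangentSpace 𝓘(ℝ, E) : M → Type _) where
  toFun := g.dualFun D
  isCovariantDerivativeOnUniv :=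
    { add := fun {Y Y' x} hY hY' _ ↦ by
        ext1 u
        refine g.ext_val fun Z hZ ↦ ?_
        have h := mvfderiv_fun_add (g.mdifferentiableAt_apply hY hZ)
          (g.mdifferentiableAt_apply hY' hZ)
        rw [g.val_dualFun D (mdifferentiableAt_add_section hY hY') hZ]
        simp [g.val_dualFun D hY hZ, g.val_dualFun D hY' hZ, h]
        abel
      leibniz := fun {Y f x} hY hf _ ↦ by
        ext1 u
        refine g.ext_val fun Z hZ ↦ ?_
        have h := mvfderiv_fun_mul hf (g.mdifferentiableAt_apply hY hZ)
        rw [g.val_dualFun D (hf.smul_section hY) hZ]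
        simp [g.val_dualFun D hY hZ, h]
        ring }

theorem dualConnection_apply
    (D : CovariantDerivative 𝓘(ℝ, E) E (TangentSpace 𝓘(ℝ, E) : M → Type _))
    {Y Z : Π x : M, TangentSpace 𝓘(ℝ, E) x} {x : M}
    (hY : MDiffAt (T% Y) x) (hZ : MDiffAt (T% Z) x) (u : TangentSpace 𝓘(ℝ, E) x) :
    g.val x (g.dualConnection D Y x u) (Z x) =
      d% (fun y ↦ g.val y (Y y) (Z y)) x u - g.val x (Y x) (D Z x u) :=
  g.val_dualFun D hY hZ u

/-! ## The gauge equation and the symplectic gap -/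

/-- `J_{∇∇^g}`: the global solutions `φ` of the gauge equation `∇^g ∘ φ = φ ∘ ∇`, that is
`∇^g_X (φ Y) = φ (∇_X Y)` for all vector fields `X` and `Y`. -/
def gaugeSolutions (D : TorsionFreeConnection E M) : Set (InfinitesimalGauge E M) :=
  {φ | ∀ X Y : Π x : M, TangentSpace 𝓘(ℝ, E) x,
    ContMDiff 𝓘(ℝ, E) (𝓘(ℝ, E).prod 𝓘(ℝ, E)) ∞ (T% X) →
    ContMDiff 𝓘(ℝ, E) (𝓘(ℝ, E).prod 𝓘(ℝ, E)) ∞ (T% Y) →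
    ∀ x, g.dualConnection D.conn (fun y ↦ φ.val y (Y y)) x (X x) = φ.val x (D.conn Y x (X x))}

/-- The skew part `Φ*` of `φ`: the endomorphism with `g(Φ* u, v) = ω(g, φ)(u, v)`. -/
def skewPart (φ : InfinitesimalGauge E M) (x : M) :
    TangentSpace 𝓘(ℝ, E) x →ₗ[ℝ] TangentSpace 𝓘(ℝ, E) x :=
  (g.sharp x).toLinearMap.comp (g.skewForm φ x)

theorem val_skewPart (φ : InfinitesimalGauge E M) (x : M) (u v : TangentSpace 𝓘(ℝ, E) x) :
    g.val x (g.skewPart φ x u) v =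
      (1 / 2 : ℝ) * (g.val x (φ.val x u) v - g.val x u (φ.val x v)) :=
  g.val_sharp x _ _

/-- `dim M - rank Φ*(x)`, a natural number because the rank is at most `dim M`. -/
def corankAt (φ : InfinitesimalGauge E M) (x : M) : ℕ :=
  Module.finrank ℝ E - Module.finrank ℝ (LinearMap.range (g.skewPart φ x))

/-- The number `s^{*b}(∇, g)`: the minimum of `dim M - rank Φ*` over the solutions `φ` of the gauge
equation. The rank of the parallel field `Φ*` does not depend on the point when `M` is connected;
the minimum here is taken over all solutions and all points. -/
def gap (D : TorsionFreeConnection E M) : ℕ∞ :=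
  ⨅ φ ∈ g.gaugeSolutions D, ⨅ x : M, (g.corankAt φ x : ℕ∞)

end PseudoRiemannianMetric

end

/-- The symplectic gap `s^{*b}(M)`: the minimum of `s^{*b}(∇, g)` over all torsion-free connections
`∇` and all metrics `g` on `M`. Infima in `ℕ∞` of nonempty families of natural numbers are minima,
and the infimum of the empty family would be `⊤`. -/
def symplecticGap (E : Type*) [NormedAddCommGroup E] [NormedSpace ℝ E] [FiniteDimensional ℝ E]
    (M : Type*) [TopologicalSpace M] [ChartedSpace E M] [IsManifold 𝓘(ℝ, E) ∞ M] : ℕ∞ :=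
  ⨅ (D : TorsionFreeConnection E M) (g : PseudoRiemannianMetric E M), g.gap D

end

/-! Duality turns the gauge equation for `φ` into the statement that the bilinear form g(φ·,·) is
∇-parallel. Its skew part ω is then parallel too, and a skew form that is parallel for a
torsion-free connection is closed. An infimum in `ℕ∞` equal to 0 is attained, so gap 0 provides ∇,
g, φ and one point where Φ* is invertible, that is, where ω is nondegenerate. To spread this over M,
let W be the Gram matrix of ω in a chart and θ the trace of the connection matrix: being parallel
gives d(det W) = 2 (det W) θ. By Grönwall the degeneracy locus is open; it is also closed, and M is
connected (`IsParallelForm.nondegenerate`). Then `TorsionFreeConnection.toSymplecticStructure`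
applies.

Conversely, let ω be symplectic. In each chart, `SymplecticStructure.christoffel` gives explicit
symmetric Christoffel symbols that make ω parallel (`coordDeriv_eq_christoffel`). Having no torsion
and making ω parallel are affine conditions on a connection, so a partition of unity glues the chart
connections into a global one. For any metric g, the field φ determined by g(φ·,·) = ω solves the
gauge equation, again by duality, and φ is its own skew part and invertible, so its corank is 0. -/

noncomputable section

open Set Topology

/-! ### Topology of M and calculus in charts -/

section

/-- A connected, locally compact, paracompact Hausdorff space is σ-compact. -/
theorem sigmaCompactSpace_of_connected_paracompact (X : Type*) [TopologicalSpace X] [T2Space X]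
    [LocallyCompactSpace X] [ParacompactSpace X] [ConnectedSpace X] : SigmaCompactSpace X := by
  choose K hKc hK using fun x : X ↦ exists_compact_mem_nhds x
  obtain ⟨V, hVo, hVU, hVf, hVK⟩ := precise_refinement (fun x ↦ interior (K x))
    (fun x ↦ isOpen_interior)
    (eq_univ_of_forall fun x ↦ mem_iUnion.2 ⟨x, mem_interior_iff_mem_nhds.2 (hK x)⟩)
  have hVc (i : X) : IsCompact (closure (V i)) :=
    (hKc i).of_isClosed_subset isClosed_closure
      (closure_minimal ((hVK i).trans interior_subset) (hKc i).isClosed)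
  -- Local finiteness lets only finitely many `V i` meet a compact set, so `next` preserves
  -- compactness. Its iterates from one point exhaust the connected component.
  let next (A : Set X) : Set X := ⋃ i ∈ {i | (V i ∩ A).Nonempty}, closure (V i)
  have next_compact {A : Set X} (hA : IsCompact A) : IsCompact (next A) :=
    (hVf.finite_nonempty_inter_compact hA).isCompact_biUnion fun i _ ↦ hVc i
  obtain ⟨x₀⟩ : Nonempty X := inferInstance
  let A (n : ℕ) : Set X := next^[n] {x₀}
  have hA_succ (n : ℕ) : A (n + 1) = next (A n) := Function.iterate_succ_apply' ..
  have hA (n : ℕ) : IsCompact (A n) := by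
    induction n with
    | zero => exact isCompact_singleton
    | succ n ih => exact hA_succ n ▸ next_compact ih
  have key {i : X} {n : ℕ} (h : (V i ∩ A n).Nonempty) : V i ⊆ ⋃ n, A n := by
    refine subset_trans ?_ (subset_iUnion A (n + 1))
    rw [hA_succ]
    exact subset_closure.trans (subset_biUnion_of_mem (u := fun i ↦ closure (V i)) h)
  -- A `V i` that meets `A n` lies in `A (n + 1)`. This gives openness, and also closedness, since a
  -- limit point lies in some open `V i` that meets some `A n`.
  have hcl : IsClopen (⋃ n, A n) := by
    refine ⟨isClosed_of_closure_subset fun y hy ↦ ?_, isOpen_iff_mem_nhds.2 fun y hy ↦ ?_⟩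
    · obtain ⟨i, hi⟩ := mem_iUnion.1 (hVU.ge (mem_univ y))
      obtain ⟨z, hzV, hz⟩ := mem_closure_iff.1 hy _ (hVo i) hi
      obtain ⟨n, hn⟩ := mem_iUnion.1 hz
      exact key ⟨z, hzV, hn⟩ hi
    · obtain ⟨n, hn⟩ := mem_iUnion.1 hy
      obtain ⟨i, hi⟩ := mem_iUnion.1 (hVU.ge (mem_univ y))
      exact Filter.mem_of_superset ((hVo i).mem_nhds hi) (key ⟨y, hi, hn⟩)
  exact SigmaCompactSpace_iff_exists_compact_covering.2
    ⟨A, hA, hcl.eq_univ ⟨x₀, mem_iUnion.2 ⟨0, rfl⟩⟩⟩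

variable {E : Type*} [NormedAddCommGroup E] [NormedSpace ℝ E]
  {M : Type*} [TopologicalSpace M] [ChartedSpace E M] [IsManifold 𝓘(ℝ, E) ∞ M]

/-! ## Coordinate vector fields -/

/-- The differential at `y` of the inverse of the chart at `c`. -/
def coordFrame (c y : M) : E →L[ℝ] TangentSpace 𝓘(ℝ, E) y :=
  (trivializationAt E (TangentSpace 𝓘(ℝ, E)) c).symmL ℝ y

/-- The differential at `y` of the chart at `c`. -/
def coordMap (c y : M) : TangentSpace 𝓘(ℝ, E) y →L[ℝ] E :=
  (trivializationAt E (TangentSpace 𝓘(ℝ, E)) c).continuousLinearMapAt ℝ y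

variable {c y : M}

theorem coordFrame_coordMap (hy : y ∈ (chartAt E c).source) (v : TangentSpace 𝓘(ℝ, E) y) :
    coordFrame c y (coordMap c y v) = v :=
  (trivializationAt E (TangentSpace 𝓘(ℝ, E)) c).symmL_continuousLinearMapAt hy v

theorem coordMap_coordFrame (hy : y ∈ (chartAt E c).source) (e : E) :
    coordMap c y (coordFrame c y e) = e :=
  (trivializationAt E (TangentSpace 𝓘(ℝ, E)) c).continuousLinearMapAt_symmL hy e

theorem contMDiffOn_section_iff_coordMap {n : ℕ∞} {X : Π x : M, TangentSpace 𝓘(ℝ, E) x} :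
    ContMDiffOn 𝓘(ℝ, E) (𝓘(ℝ, E).prod 𝓘(ℝ, E)) n (T% X) (chartAt E c).source ↔
      ContMDiffOn 𝓘(ℝ, E) 𝓘(ℝ, E) n (fun y ↦ coordMap c y (X y) : M → E) (chartAt E c).source := by
  let e := trivializationAt E (TangentSpace 𝓘(ℝ, E)) c
  have he : e.baseSet = (chartAt E c).source := rfl
  rw [← he, e.contMDiffOn_section_baseSet_iff]
  exact contMDiffOn_congr fun y hy ↦ (e.continuousLinearMapAt_apply_of_mem (R := ℝ) hy _).symm

theorem contMDiffOn_coordFrame (e : E) :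
    ContMDiffOn 𝓘(ℝ, E) (𝓘(ℝ, E).prod 𝓘(ℝ, E)) ∞ (T% fun y : M ↦ coordFrame c y e)
      (chartAt E c).source :=
  contMDiffOn_section_iff_coordMap.2
    (contMDiffOn_const.congr fun _ hy ↦ coordMap_coordFrame hy e)

theorem mdifferentiableAt_coordFrame (hy : y ∈ (chartAt E c).source) (e : E) :
    MDiffAt (T% fun y : M ↦ coordFrame c y e) y :=
  ((contMDiffOn_coordFrame e).contMDiffAt ((chartAt E c).open_source.mem_nhds hy)).mdifferentiableAt
    (by simp)

/-- Coordinate fields are chart pullbacks of constant fields on `E`. Constant fields commute, and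
pullback is compatible with the bracket. -/
theorem mlieBracket_coordFrame [CompleteSpace E] (hy : y ∈ (chartAt E c).source) (e f : E) :
    VectorField.mlieBracket 𝓘(ℝ, E) (fun y : M ↦ coordFrame c y e) (fun y ↦ coordFrame c y f) y
      = 0 := by
  let K (e : E) (x : E) : TangentSpace 𝓘(ℝ, E) x := e
  have hK (e p : E) : MDiffAt (T% (K e)) p :=
    (contMDiff_vectorSpace_iff_contDiff.2 (contDiff_const (c := e) (n := 1))).mdifferentiable
      (by simp) p
  have h (e : E) : (fun y : M ↦ coordFrame c y e) =ᶠ[𝓝 y]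
      VectorField.mpullback 𝓘(ℝ, E) 𝓘(ℝ, E) (extChartAt 𝓘(ℝ, E) c) (K e) := by
    filter_upwards [(chartAt E c).open_source.mem_nhds hy] with z hz
    have hinv : (mfderiv 𝓘(ℝ, E) 𝓘(ℝ, E) (extChartAt 𝓘(ℝ, E) c) z).inverse =
        coordFrame (E := E) c z := by
      rw [← TangentBundle.continuousLinearMapAt_trivializationAt hz]
      exact ContinuousLinearMap.inverse_eq
        (ContinuousLinearMap.ext fun e ↦ coordMap_coordFrame hz e)
        (ContinuousLinearMap.ext fun v ↦ coordFrame_coordMap hz v)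
    exact (DFunLike.congr_fun hinv e).symm
  have h0 : VectorField.mlieBracket 𝓘(ℝ, E) (K e) (K f) = 0 := by
    rw [← VectorField.mlieBracketWithin_univ, VectorField.mlieBracketWithin_eq_lieBracketWithin]
    ext p
    simp [VectorField.lieBracketWithin_eq, K]
    rfl
  refine ((h e).mlieBracket_vectorField_eq (h f)).trans ?_
  have h1 : ContMDiffAt 𝓘(ℝ, E) 𝓘(ℝ, E) ∞ (extChartAt 𝓘(ℝ, E) c) y := contMDiffAt_extChartAt' hy
  have hM : IsManifold 𝓘(ℝ, E) (minSmoothness ℝ 2) M := by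
    rw [minSmoothness_of_isRCLikeNormedField]
    infer_instance
  have hn : minSmoothness ℝ 2 ≤ ∞ := by
    rw [minSmoothness_of_isRCLikeNormedField]
    exact WithTop.coe_le_coe.2 le_top
  refine (VectorField.mpullback_mlieBracket (hK e _) (hK f _) h1 hn).symm.trans ?_
  rw [h0, VectorField.mpullback_zero, Pi.zero_apply]

/-- A field of bilinear forms read in the chart at `c`. -/
def coordBilin (c : M)
    (q : Π x : M, TangentSpace 𝓘(ℝ, E) x →L[ℝ] TangentSpace 𝓘(ℝ, E) x →L[ℝ] ℝ) (y : M) :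
    E →L[ℝ] E →L[ℝ] ℝ :=
  ContinuousLinearMap.precomp ℝ (coordFrame c y) ∘L q y ∘L coordFrame c y

theorem coordBilin_apply
    (q : Π x : M, TangentSpace 𝓘(ℝ, E) x →L[ℝ] TangentSpace 𝓘(ℝ, E) x →L[ℝ] ℝ) (e f : E) :
    coordBilin c q y e f = q y (coordFrame c y e) (coordFrame c y f) := rfl

-- The trivialization of the Hom bundle is conjugation by the tangent trivialization, so smoothness
-- of a tensor field can be tested on its coordinate expression.
set_option synthInstance.maxHeartbeats 400000 in
theorem contMDiffOn_bilin_iff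
    {q : Π x : M, TangentSpace 𝓘(ℝ, E) x →L[ℝ] TangentSpace 𝓘(ℝ, E) x →L[ℝ] ℝ} :
    ContMDiffOn 𝓘(ℝ, E) (𝓘(ℝ, E).prod 𝓘(ℝ, E →L[ℝ] E →L[ℝ] ℝ)) ∞
    (fun x ↦ TotalSpace.mk' (E →L[ℝ] E →L[ℝ] ℝ)
      (E := fun y : M ↦ TangentSpace 𝓘(ℝ, E) y →L[ℝ] TangentSpace 𝓘(ℝ, E) y →L[ℝ] ℝ) x (q x))
      (chartAt E c).source ↔
    ContMDiffOn 𝓘(ℝ, E) 𝓘(ℝ, E →L[ℝ] E →L[ℝ] ℝ) ∞ (coordBilin c q) (chartAt E c).source := by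
  let e := trivializationAt (E →L[ℝ] E →L[ℝ] ℝ)
    (fun y : M ↦ TangentSpace 𝓘(ℝ, E) y →L[ℝ] TangentSpace 𝓘(ℝ, E) y →L[ℝ] ℝ) c
  have he : e.baseSet = (chartAt E c).source := by
    simp [e, hom_trivializationAt_baseSet]
  rw [← he]
  refine (Trivialization.contMDiffOn_section_baseSet_iff (n := ∞) (F := E →L[ℝ] E →L[ℝ] ℝ)
    (IB := 𝓘(ℝ, E)) e).trans (contMDiffOn_congr fun y hy ↦ ?_)
  rw [he] at hy
  simp only [e, hom_trivializationAt_apply]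
  ext u v
  simp [ContinuousLinearMap.inCoordinates, coordBilin_apply, hy, coordFrame,
    hom_trivializationAt_apply]

theorem contMDiffOn_endo_iff
    {q : Π x : M, TangentSpace 𝓘(ℝ, E) x →L[ℝ] TangentSpace 𝓘(ℝ, E) x} :
    ContMDiffOn 𝓘(ℝ, E) (𝓘(ℝ, E).prod 𝓘(ℝ, E →L[ℝ] E)) ∞
    (fun x ↦ TotalSpace.mk' (E →L[ℝ] E)
      (E := fun y : M ↦ TangentSpace 𝓘(ℝ, E) y →L[ℝ] TangentSpace 𝓘(ℝ, E) y) x (q x))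
      (chartAt E c).source ↔
    ContMDiffOn 𝓘(ℝ, E) 𝓘(ℝ, E →L[ℝ] E) ∞ (fun y ↦ coordMap c y ∘L q y ∘L coordFrame c y)
      (chartAt E c).source := by
  let e := trivializationAt (E →L[ℝ] E)
    (fun y : M ↦ TangentSpace 𝓘(ℝ, E) y →L[ℝ] TangentSpace 𝓘(ℝ, E) y) c
  have he : e.baseSet = (chartAt E c).source := by
    simp [e, hom_trivializationAt_baseSet]
  rw [← he, e.contMDiffOn_section_baseSet_iff]
  refine contMDiffOn_congr fun y hy ↦ ?_
  simp only [e, hom_trivializationAt_apply]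
  rfl

/-- The differential of a function, read in the chart at `c`. -/
def coordDeriv {F : Type*} [NormedAddCommGroup F] [NormedSpace ℝ F] (c : M) (f : M → F) (y : M) :
    E →L[ℝ] F :=
  (mvfderiv 𝓘(ℝ, E) f y).comp (coordFrame (E := E) c y)

/-- Chain rule: the coordinate frame is the differential of the inverse chart. This lets calculus on
`E` be used for functions on the chart domain. -/
theorem coordDeriv_eq_fderiv {F : Type*} [NormedAddCommGroup F] [NormedSpace ℝ F] {f : M → F}
    (hy : y ∈ (chartAt E c).source) (hf : MDifferentiableAt 𝓘(ℝ, E) 𝓘(ℝ, F) f y) :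
    coordDeriv (E := E) c f y = fderiv ℝ (f ∘ (chartAt E c).symm) (chartAt E c y) := by
  have h1 : MDifferentiableAt 𝓘(ℝ, E) 𝓘(ℝ, E) (chartAt E c).symm (chartAt E c y) :=
    mdifferentiableAt_atlas_symm (chart_mem_atlas E c) ((chartAt E c).map_source hy)
  have h2 := mfderiv_comp_of_eq hf h1 ((chartAt E c).left_inv hy)
  rw [mfderiv_eq_fderiv] at h2
  refine Eq.trans ?_ h2.symm
  have h3 := TangentBundle.symmL_trivializationAt (I := 𝓘(ℝ, E)) hy
  simp only [modelWithCornersSelf_coe, range_id, mfderivWithin_univ] at h3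
  have h4 := congrArg (fun z ↦ (show E →L[ℝ] F from mfderiv 𝓘(ℝ, E) 𝓘(ℝ, F) f z))
    ((chartAt E c).left_inv hy)
  unfold coordDeriv coordFrame
  rw [h3]
  exact congrArg (fun L : E →L[ℝ] F ↦ L.comp (show E →L[ℝ] E from
    mfderiv 𝓘(ℝ, E) 𝓘(ℝ, E) (chartAt E c).symm (chartAt E c y))) h4.symm

theorem contMDiffOn_coordDeriv {F : Type*} [NormedAddCommGroup F] [NormedSpace ℝ F] {f : M → F}
    (hf : ContMDiffOn 𝓘(ℝ, E) 𝓘(ℝ, F) ∞ f (chartAt E c).source) :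
    ContMDiffOn 𝓘(ℝ, E) 𝓘(ℝ, E →L[ℝ] F) ∞ (coordDeriv (E := E) c f) (chartAt E c).source := by
  have h1 : ContDiffOn ℝ ∞ (f ∘ (chartAt E c).symm) (chartAt E c).target :=
    (hf.comp contMDiffOn_chart_symm fun p hp ↦ (chartAt E c).map_target hp).contDiffOn
  have h2 := h1.fderiv_of_isOpen (m := ∞) (chartAt E c).open_target (by simp)
  refine (h2.contMDiffOn.comp contMDiffOn_chart fun y hy ↦ (chartAt E c).map_source hy).congr
    fun y hy ↦ coordDeriv_eq_fderiv hy ?_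
  exact (hf.contMDiffAt ((chartAt E c).open_source.mem_nhds hy)).mdifferentiableAt (by simp)

/-- Closedness, parallelism and the gauge equation are tested on global smooth fields, whereas
coordinate fields are local. Multiplying by a bump function bridges the two without changing germs
at the point. -/
theorem exists_contMDiff_eventuallyEq [FiniteDimensional ℝ E] [T2Space M]
    {X : Π x : M, TangentSpace 𝓘(ℝ, E) x}
    {U : Set M} (hU : U ∈ 𝓝 y) (hX : ContMDiffOn 𝓘(ℝ, E) (𝓘(ℝ, E).prod 𝓘(ℝ, E)) ∞ (T% X) U) :
    ∃ X' : Π x : M, TangentSpace 𝓘(ℝ, E) x,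
      ContMDiff 𝓘(ℝ, E) (𝓘(ℝ, E).prod 𝓘(ℝ, E)) ∞ (T% X') ∧ ∀ᶠ z in 𝓝 y, X' z = X z := by
  obtain ⟨f, hf⟩ := (SmoothBumpFunction.nhds_basis_tsupport (I := 𝓘(ℝ, E)) y).mem_iff.1
    (interior_mem_nhds.2 hU)
  refine ⟨(f : M → ℝ) • X, ContMDiffOn.smul_section_of_tsupport f.contMDiff.contMDiffOn
    isOpen_interior hf.2 (hX.mono interior_subset), ?_⟩
  filter_upwards [f.eventuallyEq_one] with z hz
  simp [hz]

end

section

/-! ## Determinants and a uniqueness lemma -/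

/-- Jacobi's formula for the derivative of a determinant. -/
theorem hasFDerivAt_det {ι V : Type*} [Fintype ι] [DecidableEq ι] [NormedAddCommGroup V]
    [NormedSpace ℝ V] {A : V → Matrix ι ι ℝ} {A' : ι → ι → V →L[ℝ] ℝ} {p : V}
    (hA : ∀ i j, HasFDerivAt (fun q ↦ A q i j) (A' i j) p) :
    HasFDerivAt (fun q ↦ (A q).det) (∑ i, ∑ k, (A p).adjugate i k • A' k i) p := by
  simp only [Matrix.det_apply']
  refine (HasFDerivAt.fun_sum fun σ _ ↦ (HasFDerivAt.finsetProd fun i _ ↦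
    hA (σ i) i).const_mul ((Equiv.Perm.sign σ : ℤ) : ℝ)).congr_fderiv ?_
  ext v
  -- Cramer's rule: the i-th summand of the claimed derivative is the determinant with its i-th
  -- column differentiated, which matches the Leibniz rule applied to each permutation product.
  have h (i : ι) : ∑ k, (A p).adjugate i k * A' k i v =
      ((A p).updateCol i fun k ↦ A' k i v).det := by
    rw [← Matrix.cramer_apply, Matrix.cramer_eq_adjugate_mulVec]
    rfl
  simp only [sum_apply, smul_apply, smul_eq_mul, h,
    Matrix.det_apply', Finset.mul_sum]
  rw [Finset.sum_comm]
  refine Finset.sum_congr rfl fun i _ ↦ Finset.sum_congr rfl fun σ _ ↦ ?_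
  congr 1
  rw [← Finset.prod_erase_mul _ _ (Finset.mem_univ i)]
  simp only [Matrix.updateCol_self]
  congr 1
  exact Finset.prod_congr rfl fun j hj ↦ by rw [Matrix.updateCol_ne (Finset.ne_of_mem_erase hj)]

/-- Along the segment from `p` to `q` the function satisfies a linear differential inequality with
initial value 0, so Grönwall's bound, with both `δ` and `ε` equal to 0, vanishes. -/
theorem eq_zero_of_norm_fderiv_le {V : Type*} [NormedAddCommGroup V] [NormedSpace ℝ V]
    {F : V → ℝ} {F' : V → V →L[ℝ] ℝ} {p : V} {r C : ℝ}
    (hF : ∀ q ∈ Metric.ball p r, HasFDerivAt F (F' q) q)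
    (hC : ∀ q ∈ Metric.ball p r, ‖F' q‖ ≤ C * ‖F q‖) (hp : F p = 0) {q : V}
    (hq : q ∈ Metric.ball p r) : F q = 0 := by
  let γ (t : ℝ) : V := p + t • (q - p)
  have hγ : ∀ t ∈ Icc (0 : ℝ) 1, γ t ∈ Metric.ball p r := fun t ht ↦ by
    have := (convex_ball p r).add_smul_sub_mem (Metric.mem_ball_self (dist_nonneg.trans_lt hq)) hq ht
    exact this
  have hd : ∀ t ∈ Icc (0 : ℝ) 1, HasDerivAt (fun t ↦ F (γ t)) (F' (γ t) (q - p)) t := fun t ht ↦ by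
    have h1 : HasDerivAt γ (q - p) t := by
      simpa only [one_smul, id] using ((hasDerivAt_id t).smul_const (q - p)).const_add p
    exact (hF _ (hγ t ht)).comp_hasDerivAt t h1
  have := norm_le_gronwallBound_of_norm_deriv_right_le (f := fun t ↦ F (γ t)) (δ := 0)
    (K := C * ‖q - p‖) (ε := 0) (a := 0) (b := 1)
    (fun t ht ↦ (hd t ht).continuousAt.continuousWithinAt)
    (fun t ht ↦ (hd t (Ico_subset_Icc_self ht)).hasDerivWithinAt) (by simp [γ, hp])
    (fun t ht ↦ by
      refine ((F' (γ t)).le_opNorm _).trans ?_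
      have := mul_le_mul_of_nonneg_right (hC _ (hγ t (Ico_subset_Icc_self ht)))
        (norm_nonneg (q - p))
      linarith) 1 (by simp)
  simpa [gronwallBound, γ] using this

/-- If W is the Gram matrix of a parallel form and G the connection matrix in some direction, then
GᵀW + WG is the derivative of W. By Jacobi's formula the left side is then the derivative of det W.
-/
theorem trace_adjugate_mul_parallel {ι : Type*} [Fintype ι] [DecidableEq ι] (W G : Matrix ι ι ℝ) :
    (W.adjugate * (G.transpose * W + W * G)).trace = 2 * G.trace * W.det := by
  rw [mul_add, Matrix.trace_add, ← mul_assoc, Matrix.trace_mul_comm, ← mul_assoc, ← mul_assoc,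
    Matrix.mul_adjugate, Matrix.adjugate_mul]
  simp
  ring

theorem mvfderiv_congr {E : Type*} [NormedAddCommGroup E] [NormedSpace ℝ E]
    {M : Type*} [TopologicalSpace M] [ChartedSpace E M] {F : Type*} [NormedAddCommGroup F]
    [NormedSpace ℝ F] {f g : M → F} {x : M}
    (h : f =ᶠ[𝓝 x] g) : mvfderiv 𝓘(ℝ, E) f x = mvfderiv 𝓘(ℝ, E) g x := by
  unfold mvfderiv
  rw [h.mfderiv_eq]
  rfl

variable {E : Type*} [NormedAddCommGroup E] [NormedSpace ℝ E] [FiniteDimensional ℝ E]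
  {M : Type*} [TopologicalSpace M] [ChartedSpace E M] [IsManifold 𝓘(ℝ, E) ∞ M]

/-! ## Parallel bilinear forms -/

/-- A field of bilinear forms that is parallel for a covariant derivative. -/
def IsParallelForm (D : CovariantDerivative 𝓘(ℝ, E) E (TangentSpace 𝓘(ℝ, E) : M → Type _))
    (q : Π x : M, TangentSpace 𝓘(ℝ, E) x →L[ℝ] TangentSpace 𝓘(ℝ, E) x →L[ℝ] ℝ) : Prop :=
  ∀ Y Z : Π x : M, TangentSpace 𝓘(ℝ, E) x,
    ContMDiff 𝓘(ℝ, E) (𝓘(ℝ, E).prod 𝓘(ℝ, E)) ∞ (T% Y) →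
    ContMDiff 𝓘(ℝ, E) (𝓘(ℝ, E).prod 𝓘(ℝ, E)) ∞ (T% Z) → ∀ (x : M) (u : TangentSpace 𝓘(ℝ, E) x),
    d% (fun y ↦ q y (Y y) (Z y)) x u = q x (D Y x u) (Z x) + q x (Y x) (D Z x u)

/-- The matrix of a field of bilinear forms in the coordinate frame at `c`. -/
def coordGram (c : M)
    (q : Π x : M, TangentSpace 𝓘(ℝ, E) x →L[ℝ] TangentSpace 𝓘(ℝ, E) x →L[ℝ] ℝ) (y : M) :
    Matrix (Fin (Module.finrank ℝ E)) (Fin (Module.finrank ℝ E)) ℝ :=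
  .of fun i j ↦ coordBilin c q y (Module.finBasis ℝ E i) (Module.finBasis ℝ E j)

variable {c y : M}
  {q : Π x : M, TangentSpace 𝓘(ℝ, E) x →L[ℝ] TangentSpace 𝓘(ℝ, E) x →L[ℝ] ℝ}

theorem det_coordGram_ne_zero_iff (hy : y ∈ (chartAt E c).source) :
    (coordGram c q y).det ≠ 0 ↔ ∀ u, (∀ v, q y u v = 0) → u = 0 := by
  let B : E →ₗ[ℝ] E →ₗ[ℝ] ℝ := (ContinuousLinearMap.coeLM ℝ).comp (coordBilin c q y : _ →ₗ[ℝ] _)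
  have h : coordGram c q y = LinearMap.toMatrix₂ (Module.finBasis ℝ E) (Module.finBasis ℝ E) B := by
    ext i j
    simp [coordGram, B, LinearMap.toMatrix₂_apply]
  rw [h, ← LinearMap.separatingLeft_iff_det_ne_zero]
  constructor
  · intro hB u hu
    have : coordMap c y u = 0 := hB _ fun v ↦ by
      change q y (coordFrame c y (coordMap c y u)) (coordFrame c y v) = 0
      rw [coordFrame_coordMap hy]
      exact hu _
    rw [← coordFrame_coordMap hy u, this, map_zero]
  · intro hq e he
    have : coordFrame c y e = 0 := hq _ fun v ↦ by
      rw [← coordFrame_coordMap hy v]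
      exact he (coordMap c y v)
    rw [← coordMap_coordFrame hy e, this, map_zero]

theorem continuousOn_det_coordGram
    (hq : ContMDiff 𝓘(ℝ, E) (𝓘(ℝ, E).prod 𝓘(ℝ, E →L[ℝ] E →L[ℝ] ℝ)) ∞
      (fun x ↦ TotalSpace.mk' (E →L[ℝ] E →L[ℝ] ℝ)
        (E := fun y : M ↦ TangentSpace 𝓘(ℝ, E) y →L[ℝ] TangentSpace 𝓘(ℝ, E) y →L[ℝ] ℝ) x (q x))) :
    ContinuousOn (fun y ↦ (coordGram c q y).det) (chartAt E c).source := by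
  have h : ContinuousOn (coordBilin c q) (chartAt E c).source :=
    (contMDiffOn_bilin_iff.1 hq.contMDiffOn).continuousOn
  refine (continuous_id.matrix_det).comp_continuousOn (f := coordGram c q)
    (continuousOn_pi.2 fun i ↦ continuousOn_pi.2 fun j ↦ ?_)
  exact (h.clm_apply continuousOn_const).clm_apply continuousOn_const

/-- The Gram determinant solves d(det W) = 2 (det W) θ near `c`. As θ is continuous, it is bounded
there, and a solution that vanishes at the centre of a ball vanishes on the whole ball. -/
theorem IsParallelForm.eventually_det_coordGram_eq_zero [T2Space M]
    {D : CovariantDerivative 𝓘(ℝ, E) E (TangentSpace 𝓘(ℝ, E) : M → Type _)}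
    (hD : CovariantDerivative.ContMDiffCovariantDerivative D ∞) (hqD : IsParallelForm D q)
    (hq : ContMDiff 𝓘(ℝ, E) (𝓘(ℝ, E).prod 𝓘(ℝ, E →L[ℝ] E →L[ℝ] ℝ)) ∞
      (fun x ↦ TotalSpace.mk' (E →L[ℝ] E →L[ℝ] ℝ)
        (E := fun y : M ↦ TangentSpace 𝓘(ℝ, E) y →L[ℝ] TangentSpace 𝓘(ℝ, E) y →L[ℝ] ℝ) x (q x)))
    (h0 : (coordGram c q c).det = 0) : ∀ᶠ y in 𝓝 c, (coordGram c q y).det = 0 := by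
  let φ := chartAt E c
  let b := Module.finBasis ℝ E
  have hc : c ∈ φ.source := mem_chart_source E c
  have hU : φ.source ∈ 𝓝 c := φ.open_source.mem_nhds hc
  choose s hs hsb using fun i ↦ exists_contMDiff_eventuallyEq hU (contMDiffOn_coordFrame (b i))
  have hDs (i) : ContMDiffOn 𝓘(ℝ, E) 𝓘(ℝ, E →L[ℝ] E) ∞
      (fun y ↦ coordMap c y ∘L D (s i) y ∘L coordFrame c y) φ.source :=
    contMDiffOn_endo_iff.1 ((hD.contMDiff.contMDiff (hs i).contMDiffOn).mono (subset_univ _))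
  -- the trace of the connection matrix, as a one-form
  let θ (y : M) : E →L[ℝ] ℝ := ∑ i, (LinearMap.toContinuousLinearMap (b.coord i)) ∘L
    (coordMap c y ∘L D (s i) y ∘L coordFrame c y)
  have hθ : ContinuousAt θ c := by
    refine tendsto_finsetSum _ fun i _ ↦ ?_
    have := ((hDs i).continuousOn.continuousAt hU)
    exact (continuousAt_const (y := LinearMap.toContinuousLinearMap (b.coord i))).clm_comp this
  let w (i j) (y : M) : ℝ := coordGram c q y i j
  have hw (i j) : ContMDiffOn 𝓘(ℝ, E) 𝓘(ℝ) ∞ (w i j) φ.source :=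
    ((contMDiffOn_bilin_iff.1 hq.contMDiffOn).clm_apply contMDiffOn_const).clm_apply
      contMDiffOn_const
  -- Agreement of `s i` with the frame is required on a neighbourhood of each `y`, not just at `y`,
  -- because derivatives at `y` are compared. Any constant above `‖θ c‖` would do.
  have hgood : ∀ᶠ y in 𝓝 c, y ∈ φ.source ∧ ‖θ y‖ < ‖θ c‖ + 1 ∧
      ∀ i, ∀ᶠ z in 𝓝 y, s i z = coordFrame c z (b i) := by
    refine (Filter.Eventually.and hU ((hθ.norm.eventually_lt continuousAt_const
      (lt_add_one _)).and ?_))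
    exact Filter.eventually_all.2 fun i ↦ (hsb i).eventually_nhds
  have hder {y : M} (hy : y ∈ φ.source)
      (hsy : ∀ i, ∀ᶠ z in 𝓝 y, s i z = coordFrame c z (b i)) :
      ∑ i, ∑ k, (coordGram c q y).adjugate i k • coordDeriv (E := E) c (w k i) y =
        (2 * (coordGram c q y).det) • θ y := by
    ext e
    -- `G` is the connection matrix in the direction `e`: its i-th column holds the coordinates of
    -- the derivative of the i-th frame field.
    let G : Matrix (Fin (Module.finrank ℝ E)) (Fin (Module.finrank ℝ E)) ℝ :=
      .of fun k i ↦ b.coord k (coordMap c y (D (s i) y (coordFrame c y e)))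
    have hG (i) : D (s i) y (coordFrame c y e) = ∑ k, G k i • coordFrame c y (b k) := by
      rw [← coordFrame_coordMap hy (D (s i) y (coordFrame c y e)),
        ← b.sum_repr (coordMap c y (D (s i) y (coordFrame c y e))), map_sum]
      simp [G]
    have hwG (k i) : coordDeriv (E := E) c (w k i) y e =
        (G.transpose * coordGram c q y + coordGram c q y * G) k i := by
      have h1 : w k i =ᶠ[𝓝 y] fun z ↦ q z (s k z) (s i z) := by
        filter_upwards [hsy k, hsy i] with z hk hi
        rw [hk, hi]
        rfl
      change mvfderiv 𝓘(ℝ, E) (w k i) y (coordFrame c y e) = _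
      rw [mvfderiv_congr h1, hqD _ _ (hs k) (hs i), (hsy k).self_of_nhds, (hsy i).self_of_nhds,
        hG, hG]
      simp [Matrix.mul_apply, coordGram, coordBilin_apply, b, mul_comm]
    have hθG : θ y e = G.trace := by simp [θ, G, Matrix.trace]
    have := trace_adjugate_mul_parallel (coordGram c q y) G
    simp only [sum_apply, smul_apply, smul_eq_mul, hwG, hθG]
    rw [mul_right_comm, ← this]
    rfl
  have hgood' : {y | y ∈ φ.source ∧ ‖θ y‖ < ‖θ c‖ + 1 ∧
      ∀ i, ∀ᶠ z in 𝓝 y, s i z = coordFrame c z (b i)} ∈ 𝓝 (φ.symm (φ c)) := by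
    rw [φ.left_inv hc]
    exact hgood
  -- A ball in the chart image is chosen because the Grönwall argument runs along straight segments.
  obtain ⟨r, hr, hball⟩ := Metric.mem_nhds_iff.1 (Filter.inter_mem
    (φ.open_target.mem_nhds (φ.map_source hc))
    ((φ.continuousAt_symm (φ.map_source hc)).preimage_mem_nhds hgood'))
  have hF (p) (hp : p ∈ Metric.ball (φ c) r) :
      HasFDerivAt (fun p ↦ (coordGram c q (φ.symm p)).det)
        ((2 * (coordGram c q (φ.symm p)).det) • θ (φ.symm p)) p := by
    obtain ⟨hpt, hps, -, hpe⟩ := hball hp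
    rw [← hder hps hpe]
    refine hasFDerivAt_det (A := fun p ↦ coordGram c q (φ.symm p)) fun i j ↦ ?_
    have hwd := (hw i j).contMDiffAt (φ.open_source.mem_nhds hps)
    rw [coordDeriv_eq_fderiv hps (hwd.mdifferentiableAt (by simp)), φ.right_inv hpt]
    have h1 : ContDiffOn ℝ ∞ (w i j ∘ φ.symm) φ.target :=
      ((hw i j).comp contMDiffOn_chart_symm fun p hp ↦ φ.map_target hp).contDiffOn
    exact ((h1.contDiffAt (φ.open_target.mem_nhds hpt)).differentiableAt (by simp)).hasFDerivAt
  have hzero (p) (hp : p ∈ Metric.ball (φ c) r) : (coordGram c q (φ.symm p)).det = 0 := by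
    refine eq_zero_of_norm_fderiv_le hF (C := 2 * (‖θ c‖ + 1)) (fun p hp ↦ ?_) ?_ hp
    · have := (hball hp).2.2.1.le
      rw [norm_smul, norm_mul, Real.norm_two]
      have h2 := mul_le_mul_of_nonneg_left this (norm_nonneg (coordGram c q (φ.symm p)).det)
      linarith
    · rw [φ.left_inv hc, h0]
  filter_upwards [hU, (φ.continuousAt hc).preimage_mem_nhds (Metric.ball_mem_nhds _ hr)]
    with y hy hyb
  simpa [φ.left_inv hy] using hzero (φ y) hyb

/-- The nondegeneracy locus is open by continuity of the Gram determinant and closed because its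
vanishing propagates to neighbouring points. Connectedness then spreads nondegeneracy from one point
to all. -/
theorem IsParallelForm.nondegenerate [T2Space M] [ConnectedSpace M]
    {D : CovariantDerivative 𝓘(ℝ, E) E (TangentSpace 𝓘(ℝ, E) : M → Type _)}
    (hD : CovariantDerivative.ContMDiffCovariantDerivative D ∞) (hqD : IsParallelForm D q)
    (hq : ContMDiff 𝓘(ℝ, E) (𝓘(ℝ, E).prod 𝓘(ℝ, E →L[ℝ] E →L[ℝ] ℝ)) ∞
      (fun x ↦ TotalSpace.mk' (E →L[ℝ] E →L[ℝ] ℝ)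
        (E := fun y : M ↦ TangentSpace 𝓘(ℝ, E) y →L[ℝ] TangentSpace 𝓘(ℝ, E) y →L[ℝ] ℝ) x (q x)))
    {x : M} (hx : ∀ u, (∀ v, q x u v = 0) → u = 0) (y : M) :
    ∀ u, (∀ v, q y u v = 0) → u = 0 := by
  let S : Set M := {y | ∀ u, (∀ v, q y u v = 0) → u = 0}
  have hS {z y : M} (hy : y ∈ (chartAt E z).source) : y ∈ S ↔ (coordGram z q y).det ≠ 0 :=
    (det_coordGram_ne_zero_iff hy).symm
  have hclopen : IsClopen S := by
    refine ⟨isOpen_compl_iff.1 (isOpen_iff_mem_nhds.2 fun z hz ↦ ?_),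
      isOpen_iff_mem_nhds.2 fun z hz ↦ ?_⟩ <;>
    have hU := (chartAt E z).open_source.mem_nhds (mem_chart_source E z)
    · have h0 : (coordGram z q z).det = 0 := by
        by_contra h
        exact hz ((hS (mem_chart_source E z)).2 h)
      filter_upwards [hU, hqD.eventually_det_coordGram_eq_zero hD hq h0] with y hy hy0 hyS
      exact (hS hy).1 hyS hy0
    · have := ((continuousOn_det_coordGram hq).continuousAt hU).eventually_ne
        ((hS (mem_chart_source E z)).1 hz)
      filter_upwards [hU, this] with y hy hy0
      exact (hS hy).2 hy0
  exact (hclopen.eq_univ ⟨x, hx⟩).ge (mem_univ y)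

end

/-! ### From a gauge solution of corank 0 to a symplectic form -/

section

variable {E : Type*} [NormedAddCommGroup E] [NormedSpace ℝ E] [FiniteDimensional ℝ E]
  {M : Type*} [TopologicalSpace M] [ChartedSpace E M] [IsManifold 𝓘(ℝ, E) ∞ M]

set_option synthInstance.maxHeartbeats 400000 in
theorem contDiff_flip {V F : Type*} [NormedAddCommGroup V] [NormedSpace ℝ V] [NormedAddCommGroup F]
    [NormedSpace ℝ F] : ContDiff ℝ ∞ (fun f : V →L[ℝ] V →L[ℝ] F ↦ f.flip) :=
  IsBoundedLinearMap.contDiff (𝕜 := ℝ)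
    ⟨⟨fun _ _ ↦ rfl, fun _ _ ↦ rfl⟩, 1, one_pos, fun f ↦ by rw [one_mul, f.opNorm_flip]⟩

omit [FiniteDimensional ℝ E] in
theorem mdifferentiableAt_bilin_apply
    {q : Π x : M, TangentSpace 𝓘(ℝ, E) x →L[ℝ] TangentSpace 𝓘(ℝ, E) x →L[ℝ] ℝ}
    (hq : ContMDiff 𝓘(ℝ, E) (𝓘(ℝ, E).prod 𝓘(ℝ, E →L[ℝ] E →L[ℝ] ℝ)) ∞
      (fun x ↦ TotalSpace.mk' (E →L[ℝ] E →L[ℝ] ℝ)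
        (E := fun y : M ↦ TangentSpace 𝓘(ℝ, E) y →L[ℝ] TangentSpace 𝓘(ℝ, E) y →L[ℝ] ℝ) x (q x)))
    {Y Z : Π x : M, TangentSpace 𝓘(ℝ, E) x} {x : M}
    (hY : MDiffAt (T% Y) x) (hZ : MDiffAt (T% Z) x) :
    MDiffAt (fun y ↦ q y (Y y) (Z y)) x := by
  have : MDifferentiableAt 𝓘(ℝ, E) (𝓘(ℝ, E).prod 𝓘(ℝ))
      (fun m ↦ TotalSpace.mk' ℝ (E := Bundle.Trivial M ℝ) m (q m (Y m) (Z m))) x := by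
    apply MDifferentiableAt.clm_bundle_apply₂ (F₁ := E) (F₂ := E)
    · exact hq.mdifferentiableAt (by simp)
    · exact hY
    · exact hZ
  simp only [mdifferentiableAt_totalSpace] at this
  exact this.2

theorem exists_contMDiff_apply_eq [T2Space M] {x : M} (u : TangentSpace 𝓘(ℝ, E) x) :
    ∃ X : Π x : M, TangentSpace 𝓘(ℝ, E) x,
      ContMDiff 𝓘(ℝ, E) (𝓘(ℝ, E).prod 𝓘(ℝ, E)) ∞ (T% X) ∧ X x = u := by
  obtain ⟨X, hX, hXx⟩ := exists_contMDiff_eventuallyEq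
    ((chartAt E x).open_source.mem_nhds (mem_chart_source E x))
    (contMDiffOn_coordFrame (coordMap x x u))
  exact ⟨X, hX, hXx.self_of_nhds.trans (coordFrame_coordMap (mem_chart_source E x) u)⟩

namespace PseudoRiemannianMetric

variable (g : PseudoRiemannianMetric E M) (φ : InfinitesimalGauge E M)

/-- The form `ω(g, φ)` as a field of continuous bilinear forms. -/
def skewBilin (x : M) : TangentSpace 𝓘(ℝ, E) x →L[ℝ] TangentSpace 𝓘(ℝ, E) x →L[ℝ] ℝ :=
  LinearMap.toContinuousLinearMap
    ((LinearMap.toContinuousLinearMap : _ ≃ₗ[ℝ] (TangentSpace 𝓘(ℝ, E) x →L[ℝ] ℝ)).toLinearMap.comp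
      (g.skewForm φ x))

theorem skewBilin_apply (x : M) (u v : TangentSpace 𝓘(ℝ, E) x) :
    g.skewBilin φ x u v = (1 / 2 : ℝ) * (g.val x (φ.val x u) v - g.val x u (φ.val x v)) := rfl

/-- By symmetry of g, g(u, φ v) = g(φ v, u), so in a chart the form is half the difference of a
smooth bilinear map and its flip. -/
theorem contMDiff_skewBilin : ContMDiff 𝓘(ℝ, E) (𝓘(ℝ, E).prod 𝓘(ℝ, E →L[ℝ] E →L[ℝ] ℝ)) ∞
    (fun x ↦ TotalSpace.mk' (E →L[ℝ] E →L[ℝ] ℝ)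
      (E := fun y : M ↦ TangentSpace 𝓘(ℝ, E) y →L[ℝ] TangentSpace 𝓘(ℝ, E) y →L[ℝ] ℝ) x
      (g.skewBilin φ x)) := by
  intro c
  refine ContMDiffOn.contMDiffAt ?_
    ((chartAt E c).open_source.mem_nhds (mem_chart_source E c))
  rw [contMDiffOn_bilin_iff]
  have hg := contMDiffOn_bilin_iff.1 (g.contMDiff.contMDiffOn (s := (chartAt E c).source))
  have hφ := contMDiffOn_endo_iff.1 (φ.contMDiff.contMDiffOn (s := (chartAt E c).source))
  have h1 := hg.clm_comp hφ
  have h2 : ContMDiffOn 𝓘(ℝ, E) 𝓘(ℝ, E →L[ℝ] E →L[ℝ] ℝ) ∞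
      (fun y ↦ (coordBilin c g.val y ∘L (coordMap c y ∘L φ.val y ∘L coordFrame c y)).flip)
      (chartAt E c).source :=
    contDiff_flip.contMDiff.comp_contMDiffOn h1
  refine ((contDiff_const_smul (1 / 2 : ℝ)).contMDiff.comp_contMDiffOn (h1.sub h2)).congr fun y hy ↦ ?_
  ext u v
  simp [coordBilin_apply, skewBilin_apply, coordFrame_coordMap hy,
    g.symm y _ (φ.val y (coordFrame c y v))]

variable {g φ}

theorem isParallelForm_skewBilin [T2Space M] {D : TorsionFreeConnection E M}
    (hφ : φ ∈ g.gaugeSolutions D) : IsParallelForm D.conn (g.skewBilin φ) := by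
  intro Y Z hY hZ x u
  have hφY {Y : Π x : M, TangentSpace 𝓘(ℝ, E) x}
      (hY : ContMDiff 𝓘(ℝ, E) (𝓘(ℝ, E).prod 𝓘(ℝ, E)) ∞ (T% Y)) :
      MDiffAt (T% fun y ↦ φ.val y (Y y)) x :=
    (φ.contMDiff.clm_bundle_apply hY).mdifferentiableAt (by simp)
  -- The form g(φ·,·) itself is parallel: apply the defining formula of ∇^g to the field φY and
  -- replace ∇^g(φY) by φ(∇Y). The gauge equation takes a field `X`, so the vector `u` is extended
  -- first.
  have key {Y Z : Π x : M, TangentSpace 𝓘(ℝ, E) x}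
      (hY : ContMDiff 𝓘(ℝ, E) (𝓘(ℝ, E).prod 𝓘(ℝ, E)) ∞ (T% Y))
      (hZ : ContMDiff 𝓘(ℝ, E) (𝓘(ℝ, E).prod 𝓘(ℝ, E)) ∞ (T% Z)) :
      d% (fun y ↦ g.val y (φ.val y (Y y)) (Z y)) x u =
        g.val x (φ.val x (D.conn Y x u)) (Z x) + g.val x (φ.val x (Y x)) (D.conn Z x u) := by
    obtain ⟨X, hX, rfl⟩ := exists_contMDiff_apply_eq u
    have := g.dualConnection_apply D.conn (hφY hY) (hZ.mdifferentiableAt (by simp)) (X x)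
    rw [hφ X Y hX hY x] at this
    rw [this]
    ring
  have hd {Y Z : Π x : M, TangentSpace 𝓘(ℝ, E) x}
      (hY : ContMDiff 𝓘(ℝ, E) (𝓘(ℝ, E).prod 𝓘(ℝ, E)) ∞ (T% Y))
      (hZ : ContMDiff 𝓘(ℝ, E) (𝓘(ℝ, E).prod 𝓘(ℝ, E)) ∞ (T% Z)) :
      MDiffAt (fun y ↦ g.val y (φ.val y (Y y)) (Z y)) x :=
    g.mdifferentiableAt_apply (hφY hY) (hZ.mdifferentiableAt (by simp))
  have h1 : (fun y ↦ g.skewBilin φ y (Y y) (Z y)) = fun y ↦ (1 / 2 : ℝ) *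
      ((fun y ↦ g.val y (φ.val y (Y y)) (Z y)) - fun y ↦ g.val y (φ.val y (Z y)) (Y y)) y := by
    ext y
    simp [skewBilin_apply, g.symm y (Y y)]
  rw [h1, mvfderiv_fun_mul mdifferentiableAt_const ((hd hY hZ).sub (hd hZ hY)),
    mvfderiv_sub (hd hY hZ) (hd hZ hY)]
  simp [key hY hZ, key hZ hY, skewBilin_apply, g.symm x _ (φ.val x _), mvfderiv_const]
  ring

theorem nondegenerate_skewBilin_of_corankAt_eq_zero {x : M} (h : g.corankAt φ x = 0)
    (u : TangentSpace 𝓘(ℝ, E) x) (hu : ∀ v, g.skewBilin φ x u v = 0) : u = 0 := by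
  have hsurj : Function.Surjective (g.skewPart φ x) := by
    rw [← LinearMap.range_eq_top]
    refine Submodule.eq_top_of_finrank_eq (le_antisymm (Submodule.finrank_le _) ?_)
    exact Nat.sub_eq_zero_iff_le.1 h
  refine LinearMap.injective_iff_surjective.2 hsurj ?_
  rw [map_zero]
  exact g.nondegenerate x _ fun v ↦ (g.val_skewPart φ x u v).trans (hu v)

end PseudoRiemannianMetric

/-- A nondegenerate skew form that is parallel for a torsion-free connection is symplectic. -/
def TorsionFreeConnection.toSymplecticStructure (D : TorsionFreeConnection E M)
    (q : Π x : M, TangentSpace 𝓘(ℝ, E) x →L[ℝ] TangentSpace 𝓘(ℝ, E) x →L[ℝ] ℝ)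
    (hq : ContMDiff 𝓘(ℝ, E) (𝓘(ℝ, E).prod 𝓘(ℝ, E →L[ℝ] E →L[ℝ] ℝ)) ∞
      (fun x ↦ TotalSpace.mk' (E →L[ℝ] E →L[ℝ] ℝ)
        (E := fun y : M ↦ TangentSpace 𝓘(ℝ, E) y →L[ℝ] TangentSpace 𝓘(ℝ, E) y →L[ℝ] ℝ) x (q x)))
    (hqD : IsParallelForm D.conn q) (halt : ∀ x u, q x u u = 0)
    (hnd : ∀ x u, (∀ v, q x u v = 0) → u = 0) : SymplecticStructure E M where
  val := q
  alt := halt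
  nondegenerate := hnd
  contMDiff := hq
  closed X Y Z hX hY hZ x := by
    have hT {X Y : Π x : M, TangentSpace 𝓘(ℝ, E) x}
        (hX : ContMDiff 𝓘(ℝ, E) (𝓘(ℝ, E).prod 𝓘(ℝ, E)) ∞ (T% X))
        (hY : ContMDiff 𝓘(ℝ, E) (𝓘(ℝ, E).prod 𝓘(ℝ, E)) ∞ (T% Y)) :=
      D.conn.torsion_eq_zero_iff.1 D.torsion_eq_zero (hX.mdifferentiableAt (x := x) (by simp))
        (hY.mdifferentiableAt (by simp))
    have hskew (u v) : q x u v = - q x v u := by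
      have := halt x (u + v)
      simp only [map_add, add_apply, halt, zero_add, add_zero] at this
      linarith
    -- Parallelism expands the three derivatives into six terms, and zero torsion expands the three
    -- brackets into six. They cancel in pairs by skew symmetry.
    rw [hqD Y Z hY hZ, hqD X Z hX hZ, hqD X Y hX hY, ← hT hX hY, ← hT hX hZ, ← hT hY hZ]
    simp only [map_sub, sub_apply]
    rw [hskew (D.conn Z x (X x)) (Y x), hskew (D.conn Z x (Y x)) (X x),
      hskew (D.conn Y x (Z x)) (X x)]
    ring

theorem nonempty_symplecticStructure_of_symplecticGap_eq_zero [T2Space M] [ConnectedSpace M]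
    (h : symplecticGap E M = 0) : Nonempty (SymplecticStructure E M) := by
  simp only [symplecticGap, PseudoRiemannianMetric.gap, ENat.iInf_eq_zero, Nat.cast_eq_zero] at h
  obtain ⟨D, g, φ, hφ, x, hx⟩ := h
  have hpar := PseudoRiemannianMetric.isParallelForm_skewBilin hφ
  refine ⟨D.toSymplecticStructure _ (g.contMDiff_skewBilin φ) hpar (fun y u ↦ ?_) ?_⟩
  · rw [PseudoRiemannianMetric.skewBilin_apply, g.symm, sub_self, mul_zero]
  · exact hpar.nondegenerate D.smooth (g.contMDiff_skewBilin φ)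
      (PseudoRiemannianMetric.nondegenerate_skewBilin_of_corankAt_eq_zero hx)

end

section

variable {E : Type*} [NormedAddCommGroup E] [NormedSpace ℝ E]
  {M : Type*} [TopologicalSpace M] [ChartedSpace E M] [IsManifold 𝓘(ℝ, E) ∞ M] {c y : M}

omit [IsManifold 𝓘(ℝ, E) ∞ M] in
theorem mvfderiv_clm_comp {F G : Type*} [NormedAddCommGroup F] [NormedSpace ℝ F]
    [NormedAddCommGroup G] [NormedSpace ℝ G] (L : F →L[ℝ] G) {f : M → F}
    (hf : MDifferentiableAt 𝓘(ℝ, E) 𝓘(ℝ, F) f y) (u : TangentSpace 𝓘(ℝ, E) y) :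
    mvfderiv 𝓘(ℝ, E) (fun z ↦ L (f z)) y u = L (mvfderiv 𝓘(ℝ, E) f y u) := by
  have h := (L.hasMFDerivAt.comp y hf.hasMFDerivAt).mfderiv
  exact congrArg (fun A : TangentSpace 𝓘(ℝ, E) y →L[ℝ] G ↦ A u) h

omit [IsManifold 𝓘(ℝ, E) ∞ M] in
theorem mvfderiv_clm_apply_const {V F : Type*} [NormedAddCommGroup V] [NormedSpace ℝ V]
    [NormedAddCommGroup F] [NormedSpace ℝ F] {f : M → V →L[ℝ] F}
    (hf : MDifferentiableAt 𝓘(ℝ, E) 𝓘(ℝ, V →L[ℝ] F) f y) (v : V) (u : TangentSpace 𝓘(ℝ, E) y) :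
    mvfderiv 𝓘(ℝ, E) (fun z ↦ f z v) y u = mvfderiv 𝓘(ℝ, E) f y u v :=
  mvfderiv_clm_comp (ContinuousLinearMap.apply ℝ F v) hf u

/-! ## Connections on a chart domain -/

theorem mdifferentiableAt_coordMap_section {σ : Π x : M, TangentSpace 𝓘(ℝ, E) x}
    (hy : y ∈ (chartAt E c).source) (hσ : MDiffAt (T% σ) y) :
    MDifferentiableAt 𝓘(ℝ, E) 𝓘(ℝ, E) (fun z ↦ coordMap c z (σ z) : M → E) y := by
  let e := trivializationAt E (TangentSpace 𝓘(ℝ, E)) c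
  have he : e.baseSet = (chartAt E c).source := rfl
  refine ((e.mdifferentiableAt_section_iff 𝓘(ℝ, E) σ (he ▸ hy)).1 hσ).congr_of_eventuallyEq ?_
  filter_upwards [(chartAt E c).open_source.mem_nhds hy] with z hz
  exact e.continuousLinearMapAt_apply_of_mem (R := ℝ) hz _

/-- The connection on the domain of the chart at `c` with Christoffel symbols `Γ`: in coordinates,
the derivative of `σ` in the direction `u` is `dσ(u) + Γ(σ, u)`. -/
def chartConnection (c : M) (Γ : M → E →L[ℝ] E →L[ℝ] E) (σ : Π x : M, TangentSpace 𝓘(ℝ, E) x)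
    (y : M) : TangentSpace 𝓘(ℝ, E) y →L[ℝ] TangentSpace 𝓘(ℝ, E) y :=
  coordFrame c y ∘L (mvfderiv 𝓘(ℝ, E) (fun z ↦ coordMap c z (σ z) : M → E) y +
    Γ y (coordMap c y (σ y)) ∘L coordMap c y)

variable {Γ : M → E →L[ℝ] E →L[ℝ] E}

theorem isCovariantDerivativeOn_chartConnection :
    IsCovariantDerivativeOn E (chartConnection c Γ) (chartAt E c).source where
  add {σ τ y} hσ hτ hy := by
    have h := mvfderiv_fun_add (mdifferentiableAt_coordMap_section hy hσ)
      (mdifferentiableAt_coordMap_section hy hτ)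
    ext u
    simp [chartConnection, h]
    abel
  leibniz {σ f y} hσ hf hy := by
    have h := mvfderiv_fun_smul hf (mdifferentiableAt_coordMap_section hy hσ)
    ext u
    simp [chartConnection, h, coordFrame_coordMap hy]
    abel

theorem contMDiffOn_chartConnection (hΓ : ContMDiffOn 𝓘(ℝ, E) 𝓘(ℝ, E →L[ℝ] E →L[ℝ] E) ∞ Γ
      (chartAt E c).source) {σ : Π x : M, TangentSpace 𝓘(ℝ, E) x}
    (hσ : ContMDiffOn 𝓘(ℝ, E) (𝓘(ℝ, E).prod 𝓘(ℝ, E)) ∞ (T% σ) (chartAt E c).source) :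
    ContMDiffOn 𝓘(ℝ, E) (𝓘(ℝ, E).prod 𝓘(ℝ, E →L[ℝ] E)) ∞
    (fun x ↦ TotalSpace.mk' (E →L[ℝ] E)
      (E := fun y : M ↦ TangentSpace 𝓘(ℝ, E) y →L[ℝ] TangentSpace 𝓘(ℝ, E) y) x
      (chartConnection c Γ σ x)) (chartAt E c).source := by
  rw [contMDiffOn_endo_iff]
  have h := contMDiffOn_section_iff_coordMap.1 hσ
  refine ((contMDiffOn_coordDeriv h).add (hΓ.clm_apply h)).congr fun y hy ↦ ?_
  ext e
  simp [chartConnection, coordDeriv, coordMap_coordFrame hy]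

theorem chartConnection_coordFrame (hy : y ∈ (chartAt E c).source) (e : E) :
    chartConnection c Γ (fun z ↦ coordFrame c z e) y = coordFrame c y ∘L Γ y e ∘L coordMap c y := by
  have h : (fun z ↦ coordMap c z (coordFrame c z e) : M → E) =ᶠ[𝓝 y] fun _ ↦ e := by
    filter_upwards [(chartAt E c).open_source.mem_nhds hy] with z hz
    exact coordMap_coordFrame hz e
  rw [chartConnection, mvfderiv_congr h, mvfderiv_const, coordMap_coordFrame hy, zero_add]

/-- The torsion is tensorial in both fields, so coordinate fields suffice. Their brackets vanish,
and what remains is the antisymmetric part of Γ. -/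
theorem torsion_chartConnection [CompleteSpace E] [FiniteDimensional ℝ E]
    (hy : y ∈ (chartAt E c).source) (hΓ : ∀ e f, Γ y e f = Γ y f e)
    {X Y : Π x : M, TangentSpace 𝓘(ℝ, E) x} (hX : MDiffAt (T% X) y) (hY : MDiffAt (T% Y) y) :
    chartConnection c Γ Y y (X y) - chartConnection c Γ X y (Y y) =
      VectorField.mlieBracket 𝓘(ℝ, E) X Y y := by
  have hD := isCovariantDerivativeOn_chartConnection (c := c) (Γ := Γ)
  let T (X Y : Π x : M, TangentSpace 𝓘(ℝ, E) x) : TangentSpace 𝓘(ℝ, E) y :=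
    chartConnection c Γ Y y (X y) - chartConnection c Γ X y (Y y) -
      VectorField.mlieBracket 𝓘(ℝ, E) X Y y
  have h1 (Y : Π x : M, TangentSpace 𝓘(ℝ, E) x) : TensorialAt 𝓘(ℝ, E) E (T · Y) y :=
    { smul := fun hf hX ↦ by
        simp [T, hD.leibniz hX hf hy, VectorField.mlieBracket_smul_left hf hX]
        module
      add := fun hX hX' ↦ by
        simp [T, hD.add hX hX' hy, VectorField.mlieBracket_add_left hX hX']
        module }
  have h2 (X : Π x : M, TangentSpace 𝓘(ℝ, E) x) : TensorialAt 𝓘(ℝ, E) E (T X ·) y :=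
    { smul := fun hf hY ↦ by
        simp [T, hD.leibniz hY hf hy, VectorField.mlieBracket_smul_right hf hY]
        module
      add := fun hY hY' ↦ by
        simp [T, hD.add hY hY' hy, VectorField.mlieBracket_add_right hY hY']
        module }
  have h3 := TensorialAt.pointwise₂ (Φ := T) (fun Y _ ↦ h1 Y) (fun X _ ↦ h2 X) hX
    (mdifferentiableAt_coordFrame hy (coordMap c y (X y))) hY
    (mdifferentiableAt_coordFrame hy (coordMap c y (Y y))) (coordFrame_coordMap hy _).symm
    (coordFrame_coordMap hy _).symm
  refine sub_eq_zero.1 (h3.trans ?_)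
  simp [T, chartConnection_coordFrame hy, mlieBracket_coordFrame hy, coordMap_coordFrame hy,
    hΓ (coordMap c y (X y))]

/-- The defect ∇q is tensorial in `Y` and `Z`, since the df terms cancel. On coordinate fields it is
exactly the hypothesis on Γ. -/
theorem parallel_chartConnection [FiniteDimensional ℝ E]
    {q : Π x : M, TangentSpace 𝓘(ℝ, E) x →L[ℝ] TangentSpace 𝓘(ℝ, E) x →L[ℝ] ℝ}
    (hq : ContMDiff 𝓘(ℝ, E) (𝓘(ℝ, E).prod 𝓘(ℝ, E →L[ℝ] E →L[ℝ] ℝ)) ∞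
      (fun x ↦ TotalSpace.mk' (E →L[ℝ] E →L[ℝ] ℝ)
        (E := fun y : M ↦ TangentSpace 𝓘(ℝ, E) y →L[ℝ] TangentSpace 𝓘(ℝ, E) y →L[ℝ] ℝ) x (q x)))
    (hy : y ∈ (chartAt E c).source)
    (hΓ : ∀ u e f, coordDeriv (E := E) c (coordBilin c q) y u e f =
      coordBilin c q y (Γ y e u) f + coordBilin c q y e (Γ y f u))
    {Y Z : Π x : M, TangentSpace 𝓘(ℝ, E) x} (hY : MDiffAt (T% Y) y) (hZ : MDiffAt (T% Z) y)
    (u : TangentSpace 𝓘(ℝ, E) y) :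
    d% (fun z ↦ q z (Y z) (Z z)) y u =
      q y (chartConnection c Γ Y y u) (Z y) + q y (Y y) (chartConnection c Γ Z y u) := by
  have hD := isCovariantDerivativeOn_chartConnection (c := c) (Γ := Γ)
  let P (Y Z : Π x : M, TangentSpace 𝓘(ℝ, E) x) : ℝ := d% (fun z ↦ q z (Y z) (Z z)) y u -
    (q y (chartConnection c Γ Y y u) (Z y) + q y (Y y) (chartConnection c Γ Z y u))
  have h1 (Z : Π x : M, TangentSpace 𝓘(ℝ, E) x) (hZ : MDiffAt (T% Z) y) :
      TensorialAt 𝓘(ℝ, E) E (P · Z) y :=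
    { smul := fun hf hY ↦ by
        have h := mvfderiv_fun_mul hf (mdifferentiableAt_bilin_apply hq hY hZ)
        simp [P, hD.leibniz hY hf hy, h]
        ring
      add := fun hY hY' ↦ by
        have h := mvfderiv_fun_add (mdifferentiableAt_bilin_apply hq hY hZ)
          (mdifferentiableAt_bilin_apply hq hY' hZ)
        simp [P, hD.add hY hY' hy, h]
        ring }
  have h2 (Y : Π x : M, TangentSpace 𝓘(ℝ, E) x) (hY : MDiffAt (T% Y) y) :
      TensorialAt 𝓘(ℝ, E) E (P Y ·) y :=
    { smul := fun hf hZ ↦ by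
        have h := mvfderiv_fun_mul hf (mdifferentiableAt_bilin_apply hq hY hZ)
        simp [P, hD.leibniz hZ hf hy, h]
        ring
      add := fun hZ hZ' ↦ by
        have h := mvfderiv_fun_add (mdifferentiableAt_bilin_apply hq hY hZ)
          (mdifferentiableAt_bilin_apply hq hY hZ')
        simp [P, hD.add hZ hZ' hy, h]
        ring }
  have h3 := TensorialAt.pointwise₂ (Φ := P) h1 h2 hY
    (mdifferentiableAt_coordFrame hy (coordMap c y (Y y))) hZ
    (mdifferentiableAt_coordFrame hy (coordMap c y (Z y))) (coordFrame_coordMap hy _).symm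
    (coordFrame_coordMap hy _).symm
  refine sub_eq_zero.1 (h3.trans ?_)
  set e := coordMap c y (Y y)
  set f := coordMap c y (Z y)
  have hW : MDifferentiableAt 𝓘(ℝ, E) 𝓘(ℝ, E →L[ℝ] E →L[ℝ] ℝ) (coordBilin c q) y :=
    ((contMDiffOn_bilin_iff.1 hq.contMDiffOn).contMDiffAt
      ((chartAt E c).open_source.mem_nhds hy)).mdifferentiableAt (by simp)
  have h4 : d% (fun z ↦ coordBilin c q z e f) y u =
      coordDeriv (E := E) c (coordBilin c q) y (coordMap c y u) e f := by
    have hWe : MDifferentiableAt 𝓘(ℝ, E) 𝓘(ℝ, E →L[ℝ] ℝ) (fun z ↦ coordBilin c q z e) y :=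
      hW.clm_apply mdifferentiableAt_const
    rw [mvfderiv_clm_apply_const hWe, mvfderiv_clm_apply_const hW, coordDeriv, ContinuousLinearMap.comp_apply,
      coordFrame_coordMap hy]
  have h5 := hΓ (coordMap c y u) e f
  rw [← h4] at h5
  simp only [P, chartConnection_coordFrame hy]
  exact sub_eq_zero.2 h5

end

/-! ### Christoffel symbols of a symplectic connection -/

section

section
variable {V F : Type*} [NormedAddCommGroup V] [NormedSpace ℝ V] [NormedAddCommGroup F]
  [NormedSpace ℝ F]

/-- The bilinear map `(e, f) ↦ A (T e f + T f e) / 3`. -/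
def symmetrizeComp (A : F →L[ℝ] V) (T : V →L[ℝ] V →L[ℝ] F) : V →L[ℝ] V →L[ℝ] V :=
  ContinuousLinearMap.compL ℝ V F V A ∘L ((1 / 3 : ℝ) • (T + T.flip))

theorem symmetrizeComp_apply (A : F →L[ℝ] V) (T : V →L[ℝ] V →L[ℝ] F) (e f : V) :
    symmetrizeComp A T e f = A ((1 / 3 : ℝ) • (T e f + T f e)) := rfl

set_option synthInstance.maxHeartbeats 400000 in
theorem contMDiffOn_symmetrizeComp {E M : Type*} [NormedAddCommGroup E] [NormedSpace ℝ E]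
    [TopologicalSpace M] [ChartedSpace E M] {A : M → F →L[ℝ] V} {T : M → V →L[ℝ] V →L[ℝ] F}
    {s : Set M} (hA : ContMDiffOn 𝓘(ℝ, E) 𝓘(ℝ, F →L[ℝ] V) ∞ A s)
    (hT : ContMDiffOn 𝓘(ℝ, E) 𝓘(ℝ, V →L[ℝ] V →L[ℝ] F) ∞ T s) :
    ContMDiffOn 𝓘(ℝ, E) 𝓘(ℝ, V →L[ℝ] V →L[ℝ] V) ∞ (fun y ↦ symmetrizeComp (A y) (T y)) s := by
  have h2 := contDiff_flip.contMDiff.comp_contMDiffOn hT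
  have h3 := (contDiff_const_smul (1 / 3 : ℝ)).contMDiff.comp_contMDiffOn (hT.add h2)
  have hL : ContDiff ℝ ∞ (fun A : F →L[ℝ] V ↦ ContinuousLinearMap.compL ℝ V F V A) :=
    IsBoundedLinearMap.contDiff (𝕜 := ℝ) ⟨⟨map_add _, map_smul _⟩, 1, one_pos, fun A ↦
      (ContinuousLinearMap.opNorm_le_bound _ (norm_nonneg _) fun f ↦ A.opNorm_comp_le f).trans_eq
        (one_mul _).symm⟩
  exact (hL.contMDiff.comp_contMDiffOn hA).clm_comp h3
end

variable {E : Type*} [NormedAddCommGroup E] [NormedSpace ℝ E] [FiniteDimensional ℝ E]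

theorem isInvertible_of_nondegenerate {B : E →L[ℝ] E →L[ℝ] ℝ}
    (h : ∀ u, (∀ v, B u v = 0) → u = 0) : B.IsInvertible := by
  have hinj : Function.Injective (B : E →ₗ[ℝ] E →L[ℝ] ℝ) := by
    refine (injective_iff_map_eq_zero _).2 fun u hu ↦ h u fun v ↦ ?_
    exact DFunLike.congr_fun hu v
  have hdim : Module.finrank ℝ E = Module.finrank ℝ (E →L[ℝ] ℝ) := by
    rw [← (LinearMap.toContinuousLinearMap : (E →ₗ[ℝ] ℝ) ≃ₗ[ℝ] E →L[ℝ] ℝ).finrank_eq]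
    exact (Subspace.dual_finrank_eq (K := ℝ) (V := E)).symm
  refine ⟨(LinearEquiv.ofInjectiveOfFinrankEq _ hinj hdim).toContinuousLinearEquiv, ?_⟩
  ext u v
  rfl

variable {M : Type*} [TopologicalSpace M] [ChartedSpace E M] [IsManifold 𝓘(ℝ, E) ∞ M] {c y : M}

theorem isInvertible_coordBilin (hy : y ∈ (chartAt E c).source)
    {q : Π x : M, TangentSpace 𝓘(ℝ, E) x →L[ℝ] TangentSpace 𝓘(ℝ, E) x →L[ℝ] ℝ}
    (hq : ∀ u, (∀ v, q y u v = 0) → u = 0) : (coordBilin c q y).IsInvertible := by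
  refine isInvertible_of_nondegenerate fun e he ↦ ?_
  have : coordFrame c y e = 0 := hq _ fun v ↦ by
    rw [← coordFrame_coordMap hy v]
    exact he (coordMap c y v)
  rw [← coordMap_coordFrame hy e, this, map_zero]

/-- Inversion is smooth at invertible operators. This makes raising an index smooth, both for the
Christoffel symbols and for the gauge field attached to ω. -/
theorem contMDiffOn_inverse_coordBilin
    {q : Π x : M, TangentSpace 𝓘(ℝ, E) x →L[ℝ] TangentSpace 𝓘(ℝ, E) x →L[ℝ] ℝ}
    (hq : ContMDiff 𝓘(ℝ, E) (𝓘(ℝ, E).prod 𝓘(ℝ, E →L[ℝ] E →L[ℝ] ℝ)) ∞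
      (fun x ↦ TotalSpace.mk' (E →L[ℝ] E →L[ℝ] ℝ)
        (E := fun y : M ↦ TangentSpace 𝓘(ℝ, E) y →L[ℝ] TangentSpace 𝓘(ℝ, E) y →L[ℝ] ℝ) x (q x)))
    (hnd : ∀ y u, (∀ v, q y u v = 0) → u = 0) :
    ContMDiffOn 𝓘(ℝ, E) 𝓘(ℝ, (E →L[ℝ] ℝ) →L[ℝ] E) ∞ (fun y ↦ (coordBilin c q y).inverse)
      (chartAt E c).source := by
  have : CompleteSpace E := FiniteDimensional.complete ℝ E
  intro y hy
  exact (isInvertible_coordBilin hy (hnd y)).contDiffAt_map_inverse.contMDiffAt.comp_contMDiffWithinAt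
    y (contMDiffOn_bilin_iff.1 hq.contMDiffOn y hy)

namespace SymplecticStructure

variable (S : SymplecticStructure E M)

omit [FiniteDimensional ℝ E] in
theorem val_swap (x : M) (u v : TangentSpace 𝓘(ℝ, E) x) : S.val x u v = - S.val x v u := by
  have := S.alt x (u + v)
  simp only [map_add, add_apply, S.alt, zero_add, add_zero] at this
  linarith

omit [FiniteDimensional ℝ E] in
theorem coordDeriv_apply_eq (hy : y ∈ (chartAt E c).source) (u e f : E) :
    coordDeriv (E := E) c (coordBilin c S.val) y u e f =
      mvfderiv 𝓘(ℝ, E) (fun z ↦ coordBilin c S.val z e f) y (coordFrame c y u) := by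
  have hW : MDifferentiableAt 𝓘(ℝ, E) 𝓘(ℝ, E →L[ℝ] E →L[ℝ] ℝ) (coordBilin c S.val) y :=
    ((contMDiffOn_bilin_iff.1 S.contMDiff.contMDiffOn).contMDiffAt
      ((chartAt E c).open_source.mem_nhds hy)).mdifferentiableAt (by simp)
  have hWe : MDifferentiableAt 𝓘(ℝ, E) 𝓘(ℝ, E →L[ℝ] ℝ) (fun z ↦ coordBilin c S.val z e) y :=
    hW.clm_apply mdifferentiableAt_const
  rw [mvfderiv_clm_apply_const hWe, mvfderiv_clm_apply_const hW, coordDeriv,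
    ContinuousLinearMap.comp_apply]

theorem coordDeriv_swap (hy : y ∈ (chartAt E c).source) (u e f : E) :
    coordDeriv (E := E) c (coordBilin c S.val) y u e f =
      - coordDeriv (E := E) c (coordBilin c S.val) y u f e := by
  rw [S.coordDeriv_apply_eq hy, S.coordDeriv_apply_eq hy]
  have : (fun z ↦ coordBilin c S.val z e f) = - fun z ↦ coordBilin c S.val z f e :=
    funext fun z ↦ S.val_swap z _ _
  rw [this, mvfderiv_neg]
  rfl

/-- This is dω = 0 on coordinate fields, where the bracket terms vanish. The fields are extended
globally; brackets and derivatives see only their germs at `y`. -/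
theorem coordDeriv_cyclic [T2Space M] (hy : y ∈ (chartAt E c).source) (u e f : E) :
    coordDeriv (E := E) c (coordBilin c S.val) y u e f +
      coordDeriv (E := E) c (coordBilin c S.val) y e f u +
      coordDeriv (E := E) c (coordBilin c S.val) y f u e = 0 := by
  have : CompleteSpace E := FiniteDimensional.complete ℝ E
  have hU := (chartAt E c).open_source.mem_nhds hy
  choose s hs hse using fun e ↦ exists_contMDiff_eventuallyEq hU (contMDiffOn_coordFrame (E := E) e)
  have hd (u e f : E) : coordDeriv (E := E) c (coordBilin c S.val) y u e f =
      d% (fun z ↦ S.val z (s e z) (s f z)) y (s u y) := by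
    rw [S.coordDeriv_apply_eq hy, (hse u).self_of_nhds]
    refine DFunLike.congr_fun (mvfderiv_congr ?_) _
    filter_upwards [hse e, hse f] with z he hf
    rw [he, hf]
    rfl
  have hb (e f : E) : VectorField.mlieBracket 𝓘(ℝ, E) (s e) (s f) y = 0 :=
    (Filter.EventuallyEq.mlieBracket_vectorField_eq (hse e) (hse f)).trans
      (mlieBracket_coordFrame hy e f)
  have := S.closed _ _ _ (hs u) (hs e) (hs f) y
  simp only [← hd, hb, map_zero, zero_apply, sub_zero, add_zero] at this
  rw [S.coordDeriv_swap hy e f u]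
  linarith

/-- Christoffel symbols in the chart at `c` of a torsion-free connection with `∇ω = 0`:
`ω(Γ(e, u), f) = (u ω(e, f) + e ω(u, f)) / 3`. -/
def christoffel (c y : M) : E →L[ℝ] E →L[ℝ] E :=
  symmetrizeComp (coordBilin c S.val y).inverse (coordDeriv (E := E) c (coordBilin c S.val) y)

omit [FiniteDimensional ℝ E] in
theorem christoffel_symm (e f : E) : S.christoffel c y e f = S.christoffel c y f e := by
  rw [christoffel, symmetrizeComp_apply, symmetrizeComp_apply, add_comm]

theorem coordBilin_christoffel (hy : y ∈ (chartAt E c).source) (e u f : E) :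
    coordBilin c S.val y (S.christoffel c y e u) f =
      (1 / 3 : ℝ) * (coordDeriv (E := E) c (coordBilin c S.val) y e u f +
        coordDeriv (E := E) c (coordBilin c S.val) y u e f) := by
  have := isInvertible_coordBilin hy (S.nondegenerate y)
  rw [christoffel, symmetrizeComp_apply, this.self_apply_inverse]
  rfl

/-- Three times the right side is 2 u ω(e, f) + e ω(u, f) + f ω(e, u), and by closedness the last
two terms add up to u ω(e, f). This is why the symbols carry the factor 1/3. -/
theorem coordDeriv_eq_christoffel [T2Space M] (hy : y ∈ (chartAt E c).source) (u e f : E) :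
    coordDeriv (E := E) c (coordBilin c S.val) y u e f =
      coordBilin c S.val y (S.christoffel c y e u) f +
        coordBilin c S.val y e (S.christoffel c y f u) := by
  have h : coordBilin c S.val y e (S.christoffel c y f u) =
      - coordBilin c S.val y (S.christoffel c y f u) e := S.val_swap y _ _
  rw [h, S.coordBilin_christoffel hy, S.coordBilin_christoffel hy]
  have h1 := S.coordDeriv_cyclic hy u e f
  have h2 := S.coordDeriv_swap hy u f e
  have h3 := S.coordDeriv_swap hy e u f
  have h4 := S.coordDeriv_swap hy f u e
  linarith

theorem contMDiffOn_christoffel : ContMDiffOn 𝓘(ℝ, E) 𝓘(ℝ, E →L[ℝ] E →L[ℝ] E) ∞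
    (S.christoffel c) (chartAt E c).source :=
  contMDiffOn_symmetrizeComp (contMDiffOn_inverse_coordBilin S.contMDiff S.nondegenerate)
    (contMDiffOn_coordDeriv (contMDiffOn_bilin_iff.1 S.contMDiff.contMDiffOn))

end SymplecticStructure

end

section

variable {E : Type*} [NormedAddCommGroup E] [NormedSpace ℝ E] [FiniteDimensional ℝ E]
  {M : Type*} [TopologicalSpace M] [ChartedSpace E M] [IsManifold 𝓘(ℝ, E) ∞ M]

/-! ## Gluing connections -/

variable {ρ : SmoothPartitionOfUnity M 𝓘(ℝ, E) M univ}
  (hρ : ρ.IsSubordinate fun c ↦ (chartAt E c).source) (Γ : M → M → E →L[ℝ] E →L[ℝ] E)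

omit [FiniteDimensional ℝ E] [IsManifold 𝓘(ℝ, E) ∞ M] in
theorem SmoothPartitionOfUnity.IsSubordinate.mem_of_mem_finsupport {U : M → Set M}
    (h : ρ.IsSubordinate U) {c x : M} (hc : c ∈ ρ.finsupport x) : x ∈ U c :=
  h c (subset_closure ((ρ.mem_finsupport x).1 hc))

/-- The combination of the chart connections with Christoffel symbols `Γ c` by a partition of
unity. -/
def gluedConnection : CovariantDerivative 𝓘(ℝ, E) E (TangentSpace 𝓘(ℝ, E) : M → Type _) where
  toFun σ x := ∑ c ∈ ρ.finsupport x, ρ c x • chartConnection c (Γ c) σ x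
  isCovariantDerivativeOnUniv :=
    { add := fun {σ τ x} hσ hτ _ ↦ by
        rw [← Finset.sum_add_distrib]
        refine Finset.sum_congr rfl fun c hc ↦ ?_
        rw [isCovariantDerivativeOn_chartConnection.add hσ hτ (hρ.mem_of_mem_finsupport hc),
          smul_add]
      leibniz := fun {σ f x} hσ hf _ ↦ by
        rw [Finset.smul_sum]
        trans ∑ c ∈ ρ.finsupport x, (f x • ρ c x • chartConnection c (Γ c) σ x +
          ρ c x • (mvfderiv 𝓘(ℝ, E) f x).smulRight (σ x))
        · refine Finset.sum_congr rfl fun c hc ↦ ?_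
          rw [isCovariantDerivativeOn_chartConnection.leibniz hσ hf (hρ.mem_of_mem_finsupport hc),
            smul_add, smul_comm]
        · rw [Finset.sum_add_distrib, ← Finset.sum_smul, ρ.sum_finsupport x (mem_univ x),
            one_smul] }

theorem gluedConnection_apply (σ : Π x : M, TangentSpace 𝓘(ℝ, E) x) (x : M)
    (u : TangentSpace 𝓘(ℝ, E) x) : gluedConnection hρ Γ σ x u =
      ∑ c ∈ ρ.finsupport x, ρ c x • chartConnection c (Γ c) σ x u := by
  change (∑ c ∈ ρ.finsupport x, ρ c x • chartConnection c (Γ c) σ x) u = _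
  simp

variable {Γ}

theorem contMDiffCovariantDerivative_gluedConnection
    (hΓ : ∀ c, ContMDiffOn 𝓘(ℝ, E) 𝓘(ℝ, E →L[ℝ] E →L[ℝ] E) ∞ (Γ c) (chartAt E c).source) :
    CovariantDerivative.ContMDiffCovariantDerivative (gluedConnection hρ Γ) ∞ where
  contMDiff :=
    { contMDiff := fun {σ} hσ ↦ by
        have h1 (c : M) := ContMDiffOn.smul_section_of_tsupport (ρ c).contMDiff.contMDiffOn
          (chartAt E c).open_source (hρ c)
          (contMDiffOn_chartConnection (hΓ c) (σ := σ) (ContMDiffOn.mono hσ (subset_univ _)))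
        refine (ContMDiff.finsum_section_of_locallyFinite
          (ρ.locallyFinite.subset fun c x hx ↦ ?_) h1).contMDiffOn.congr fun x _ ↦ ?_
        · exact left_ne_zero_of_smul hx
        · congr 1
          exact ρ.sum_finsupport_smul_eq_finsum x fun c _ ↦ chartConnection c (Γ c) σ x }

/-- Each chart connection that contributes at the point has torsion 0, so its antisymmetrization is
the bracket; the weights add up to 1. -/
theorem torsion_gluedConnection [T2Space M] [CompleteSpace E]
    (hΓ : ∀ c y e f, Γ c y e f = Γ c y f e) : (gluedConnection hρ Γ).torsion = 0 := by
  rw [CovariantDerivative.torsion_eq_zero_iff]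
  intro X Y x hX hY
  rw [gluedConnection_apply, gluedConnection_apply, ← Finset.sum_sub_distrib]
  trans ∑ c ∈ ρ.finsupport x, ρ c x • VectorField.mlieBracket 𝓘(ℝ, E) X Y x
  · refine Finset.sum_congr rfl fun c hc ↦ ?_
    rw [← smul_sub, torsion_chartConnection (hρ.mem_of_mem_finsupport hc) (hΓ c x) hX hY]
  · rw [← Finset.sum_smul, ρ.sum_finsupport x (mem_univ x), one_smul]

theorem parallel_gluedConnection
    {q : Π x : M, TangentSpace 𝓘(ℝ, E) x →L[ℝ] TangentSpace 𝓘(ℝ, E) x →L[ℝ] ℝ}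
    (hq : ContMDiff 𝓘(ℝ, E) (𝓘(ℝ, E).prod 𝓘(ℝ, E →L[ℝ] E →L[ℝ] ℝ)) ∞
      (fun x ↦ TotalSpace.mk' (E →L[ℝ] E →L[ℝ] ℝ)
        (E := fun y : M ↦ TangentSpace 𝓘(ℝ, E) y →L[ℝ] TangentSpace 𝓘(ℝ, E) y →L[ℝ] ℝ) x (q x)))
    (hΓ : ∀ c, ∀ y ∈ (chartAt E c).source, ∀ u e f,
      coordDeriv (E := E) c (coordBilin c q) y u e f =
        coordBilin c q y (Γ c y e u) f + coordBilin c q y e (Γ c y f u))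
    {Y Z : Π x : M, TangentSpace 𝓘(ℝ, E) x} {x : M} (hY : MDiffAt (T% Y) x)
    (hZ : MDiffAt (T% Z) x) (u : TangentSpace 𝓘(ℝ, E) x) :
    d% (fun z ↦ q z (Y z) (Z z)) x u =
      q x (gluedConnection hρ Γ Y x u) (Z x) + q x (Y x) (gluedConnection hρ Γ Z x u) := by
  rw [gluedConnection_apply, gluedConnection_apply]
  simp only [map_sum, map_smul, sum_apply, smul_apply]
  rw [← Finset.sum_add_distrib]
  trans ∑ c ∈ ρ.finsupport x, ρ c x • d% (fun z ↦ q z (Y z) (Z z)) x u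
  · rw [← Finset.sum_smul, ρ.sum_finsupport x (mem_univ x), one_smul]
  · refine Finset.sum_congr rfl fun c hc ↦ ?_
    have hx := hρ.mem_of_mem_finsupport hc
    rw [parallel_chartConnection hq hx (hΓ c x hx) hY hZ, smul_add]

namespace SymplecticStructure

/-- A torsion-free connection for which the symplectic form is parallel. -/
def connection [T2Space M] (S : SymplecticStructure E M)
    (hρ : ρ.IsSubordinate fun c ↦ (chartAt E c).source) : TorsionFreeConnection E M where
  conn := gluedConnection hρ S.christoffel
  smooth := contMDiffCovariantDerivative_gluedConnection hρ fun _ ↦ S.contMDiffOn_christoffel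
  torsion_eq_zero :=
    have : CompleteSpace E := FiniteDimensional.complete ℝ E
    torsion_gluedConnection hρ fun _ _ e f ↦ S.christoffel_symm e f

theorem parallel_connection [T2Space M] (S : SymplecticStructure E M)
    (hρ : ρ.IsSubordinate fun c ↦ (chartAt E c).source) {Y Z : Π x : M, TangentSpace 𝓘(ℝ, E) x}
    {x : M} (hY : MDiffAt (T% Y) x) (hZ : MDiffAt (T% Z) x) (u : TangentSpace 𝓘(ℝ, E) x) :
    d% (fun z ↦ S.val z (Y z) (Z z)) x u = S.val x ((S.connection hρ).conn Y x u) (Z x) +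
      S.val x (Y x) ((S.connection hρ).conn Z x u) :=
  parallel_gluedConnection hρ S.contMDiff (fun _ _ hy ↦ S.coordDeriv_eq_christoffel hy) hY hZ u

end SymplecticStructure

end

section

/-! ## Riemannian metrics and the gauge transformation of a symplectic form -/

variable {E : Type*} [NormedAddCommGroup E] [NormedSpace ℝ E] [FiniteDimensional ℝ E]
  {M : Type*} [TopologicalSpace M] [ChartedSpace E M] [IsManifold 𝓘(ℝ, E) ∞ M]

theorem exists_symm_posDef (E : Type*) [NormedAddCommGroup E] [NormedSpace ℝ E]
    [FiniteDimensional ℝ E] :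
    ∃ B : E →L[ℝ] E →L[ℝ] ℝ, (∀ u v, B u v = B v u) ∧ ∀ u, u ≠ 0 → 0 < B u u := by
  let b := Module.finBasis ℝ E
  let l (i) : E →L[ℝ] ℝ := LinearMap.toContinuousLinearMap (b.coord i)
  refine ⟨∑ i, (l i).smulRight (l i), fun u v ↦ ?_, fun u hu ↦ ?_⟩
  · simp [mul_comm]
  · obtain ⟨i, hi⟩ : ∃ i, b.coord i u ≠ 0 := by
      by_contra! h
      exact hu (b.ext_elem fun i ↦ by simpa using h i)
    simp only [sum_apply, ContinuousLinearMap.smulRight_apply, smul_apply, smul_eq_mul]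
    exact Finset.sum_pos' (fun j _ ↦ mul_self_nonneg _) ⟨i, Finset.mem_univ _, mul_self_pos.2 hi⟩

-- Positive definite symmetric forms make up a convex subset of each fibre, and they exist locally
-- by pulling back a constant one through a chart. Convexity allows gluing, which mere nondegeneracy
-- would not.
set_option maxHeartbeats 1600000 in
set_option synthInstance.maxHeartbeats 400000 in
theorem nonempty_pseudoRiemannianMetric [T2Space M] [SigmaCompactSpace M] :
    Nonempty (PseudoRiemannianMetric E M) := by
  let P (x : M) : Set (TangentSpace 𝓘(ℝ, E) x →L[ℝ] TangentSpace 𝓘(ℝ, E) x →L[ℝ] ℝ) :=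
    {B | (∀ u v, B u v = B v u) ∧ ∀ u, u ≠ 0 → 0 < B u u}
  have hP (x : M) : Convex ℝ (P x) := by
    rintro B ⟨hB, hB'⟩ C ⟨hC, hC'⟩ s t hs ht hst
    refine ⟨fun u v ↦ ?_, fun u hu ↦ ?_⟩
    · simp [hB u v, hC u v]
    · simp only [add_apply, smul_apply, smul_eq_mul]
      have h1 := hB' u hu
      have h2 := hC' u hu
      rcases hs.eq_or_lt with rfl | hs
      · rw [zero_add] at hst
        simpa [hst] using h2
      · positivity
  obtain ⟨B, hB, hB'⟩ := exists_symm_posDef E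
  obtain ⟨g, hg⟩ := exists_contMDiffSection_forall_mem_convex_of_local 𝓘(ℝ, E) (n := ⊤)
    (F_fiber := E →L[ℝ] E →L[ℝ] ℝ)
    (fun x : M ↦ TangentSpace 𝓘(ℝ, E) x →L[ℝ] TangentSpace 𝓘(ℝ, E) x →L[ℝ] ℝ) P hP fun c ↦ by
      refine ⟨(chartAt E c).source, (chartAt E c).open_source.mem_nhds (mem_chart_source E c),
        fun y ↦ ContinuousLinearMap.precomp ℝ (coordMap c y) ∘L B ∘L coordMap c y, ?_,
        fun y hy ↦ ⟨fun u v ↦ hB _ _, fun u hu ↦ hB' _ fun h ↦ hu ?_⟩⟩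
      · refine contMDiffOn_bilin_iff.2 (contMDiffOn_const (c := B) |>.congr fun y hy ↦ ?_)
        ext e f
        simp [coordBilin_apply, coordMap_coordFrame hy]
      · have h' : coordMap c y u = 0 := h
        rw [← coordFrame_coordMap hy u, h', map_zero]
  exact ⟨{
    val := g
    symm := fun x ↦ (hg x).1
    nondegenerate := fun x u hu ↦ by
      by_contra h
      exact ((hg x).2 u h).ne' (hu u)
    contMDiff := g.contMDiff }⟩

namespace PseudoRiemannianMetric

variable (g : PseudoRiemannianMetric E M) (S : SymplecticStructure E M)

/-- The gauge transformation `φ` with `g(φ u, v) = S(u, v)`. -/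
def gaugeOfSymplectic : InfinitesimalGauge E M where
  val x := LinearMap.toContinuousLinearMap ((g.sharp x).toLinearMap.comp
    ((ContinuousLinearMap.coeLM ℝ).comp (S.val x : _ →ₗ[ℝ] _)))
  contMDiff := by
    intro c
    refine ContMDiffOn.contMDiffAt ?_
      ((chartAt E c).open_source.mem_nhds (mem_chart_source E c))
    rw [contMDiffOn_endo_iff]
    -- In coordinates φ is the inverse of the matrix map of g composed with that of ω.
    refine ((contMDiffOn_inverse_coordBilin g.contMDiff g.nondegenerate).clm_comp
      (contMDiffOn_bilin_iff.1 S.contMDiff.contMDiffOn)).congr fun y hy ↦ ?_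
    ext e
    have hinv := isInvertible_coordBilin hy (g.nondegenerate y)
    refine hinv.injective ?_
    refine Eq.trans ?_ (hinv.self_apply_inverse _).symm
    ext f
    simp only [coordBilin_apply, ContinuousLinearMap.comp_apply, coordFrame_coordMap hy]
    exact g.val_sharp y _ _

theorem val_gaugeOfSymplectic (x : M) (u v : TangentSpace 𝓘(ℝ, E) x) :
    g.val x ((g.gaugeOfSymplectic S).val x u) v = S.val x u v :=
  g.val_sharp x _ _

/-- Pair with Z: g(∇^g_X(φY), Z) = X ω(Y, Z) - ω(Y, ∇_X Z), which equals ω(∇_X Y, Z) = g(φ(∇_X Y),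
Z) because ω is parallel. -/
theorem gaugeOfSymplectic_mem_gaugeSolutions {D : TorsionFreeConnection E M}
    (hD : ∀ {Y Z : Π x : M, TangentSpace 𝓘(ℝ, E) x} {x : M}, MDiffAt (T% Y) x →
      MDiffAt (T% Z) x → ∀ u : TangentSpace 𝓘(ℝ, E) x, d% (fun z ↦ S.val z (Y z) (Z z)) x u =
        S.val x (D.conn Y x u) (Z x) + S.val x (Y x) (D.conn Z x u)) :
    g.gaugeOfSymplectic S ∈ g.gaugeSolutions D := by
  intro X Y hX hY x
  have hφY : MDiffAt (T% fun y ↦ (g.gaugeOfSymplectic S).val y (Y y)) x :=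
    ((g.gaugeOfSymplectic S).contMDiff.clm_bundle_apply hY).mdifferentiableAt (by simp)
  refine g.ext_val fun Z hZ ↦ ?_
  rw [g.dualConnection_apply _ hφY hZ]
  simp only [val_gaugeOfSymplectic]
  rw [hD (hY.mdifferentiableAt (by simp)) hZ, add_sub_cancel_right]

/-- Since ω is skew, g(u, φ v) = -ω(u, v), so the skew part pairs to ω itself and is injective. -/
theorem corankAt_gaugeOfSymplectic (x : M) : g.corankAt (g.gaugeOfSymplectic S) x = 0 := by
  have hinj : Function.Injective (g.skewPart (g.gaugeOfSymplectic S) x) := by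
    refine (injective_iff_map_eq_zero _).2 fun u hu ↦ S.nondegenerate x u fun v ↦ ?_
    have h := g.val_skewPart (g.gaugeOfSymplectic S) x u v
    rw [hu, g.symm x u, val_gaugeOfSymplectic, val_gaugeOfSymplectic, S.val_swap x v u,
      map_zero, zero_apply] at h
    linarith
  rw [corankAt, LinearMap.finrank_range_of_inj hinj]
  exact Nat.sub_self _

end PseudoRiemannianMetric

theorem symplecticGap_eq_zero [T2Space M] [SigmaCompactSpace M] [Nonempty M]
    (S : SymplecticStructure E M) : symplecticGap E M = 0 := by
  obtain ⟨ρ, hρ⟩ := SmoothPartitionOfUnity.exists_isSubordinate_chartAt_source 𝓘(ℝ, E) M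
  obtain ⟨g⟩ := nonempty_pseudoRiemannianMetric (E := E) (M := M)
  obtain ⟨x⟩ := ‹Nonempty M›
  simp only [symplecticGap, PseudoRiemannianMetric.gap, ENat.iInf_eq_zero, Nat.cast_eq_zero]
  exact ⟨S.connection hρ, g, g.gaugeOfSymplectic S,
    g.gaugeOfSymplectic_mem_gaugeSolutions S (S.parallel_connection hρ), x,
    g.corankAt_gaugeOfSymplectic S x⟩

end

end

theorem mainTheorem8 (E : Type*) [NormedAddCommGroup E] [NormedSpace ℝ E] [FiniteDimensional ℝ E]
    (M : Type*) [TopologicalSpace M] [T2Space M] [ParacompactSpace M] [ConnectedSpace M]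
    [ChartedSpace E M] [IsManifold 𝓘(ℝ, E) ∞ M] :
    symplecticGap E M = 0 ↔ Nonempty (SymplecticStructure E M) := by
  have : LocallyCompactSpace M := ChartedSpace.locallyCompactSpace E M
  -- σ-compactness is what the partitions of unity behind the metric and the connection require.
  have : SigmaCompactSpace M := sigmaCompactSpace_of_connected_paracompact M
  exact ⟨nonempty_symplecticStructure_of_symplecticGap_eq_zero,
    fun ⟨S⟩ ↦ symplecticGap_eq_zero S⟩
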